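/- All graphs are finite and simple. For a graph $G$ let $Q(G)=D(G)+A(G)$ be its signless Laplacian matrix (degree matrix plus adjacency matrix), let $q_{\min}(G)$ be the least eigenvalue of $Q(G)$, and let $\gamma(G)$ be its domination number, i.e. the minimum size of a set $S$ of vertices such that every vertex outside $S$ is adjacent to a vertex of $S$. For an odd integer $g$ with $3\le g<n$ and $1\le k\le n-g$, let $U_n^k(g)$ be the graph of order $n$ obtained from a cycle $C_g$ and a star $S_{1,k}$ with $k$ leaves by joining one vertex of the cycle to the centre of the star by a path on $l=n+1-g-k$ vertices (both ends included; if $l=1$, the cycle vertex and the centre are identified). If at least one of the graphs $U_n^k(g)$, $1\le k\le n-g$, has domination number $\gamma$, let $V_n^\gamma(g)$ denote the one among those with the smallest $k$. **Theorem.** Let $n\ge 4$ and $1\le\gamma\le\frac{n+1}{3}$ be integers. Then $V_n^\gamma(3)$ is defined, and it is the unique graph, up to isomorphism, that minimizes $q_{\min}$ among all connected non-bipartite graphs of order $n$ with domination number $\gamma$. That is, $V_n^\gamma(3)$ is such a graph, and every such graph $G$ satisfies $q_{\min}(G)\ge q_{\min}(V_n^\gamma(3))$, with equality if and only if $G\cong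 V_n^\gamma(3)$. Moreover, for every odd $n\ge 5$, the graph $U_n^1(n-2)$ has the same domination number as the cycle $C_n$, and $q_{\min}(C_n)>q_{\min}(U_n^1(n-2))$. -/

import Mathlib

/-- The signless Laplacian matrix `Q(G) = D(G) + A(G)` of a finite simple graph. -/
noncomputable def signlessLaplacian {W : Type*} [Fintype W] (G : SimpleGraph W) :
    Matrix W W ℝ := by
  classical
  exact G.degMatrix ℝ + G.adjMatrix ℝ

/-- The least `Q`-eigenvalue of `G`: the least eigenvalue of the signless Laplacian matrix. -/
noncomputable def qMin {W : Type*} [Fintype W] (G : SimpleGraph W) : ℝ := by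
  classical
  exact sInf {μ : ℝ | Module.End.HasEigenvalue (Matrix.toLin' (signlessLaplacian G)) μ}

open Classical in
/-- On a non-empty graph, `qMin` really is the least element of the set of `Q`-eigenvalues. -/
theorem isLeast_qMin {W : Type*} [Fintype W] [Nonempty W] (G : SimpleGraph W) :
    IsLeast {μ : ℝ | Module.End.HasEigenvalue (Matrix.toLin' (signlessLaplacian G)) μ}
      (qMin G) := by
  have hQ : (signlessLaplacian G).IsHermitian := by
    unfold signlessLaplacian
    rw [Matrix.IsHermitian, Matrix.conjTranspose_eq_transpose_of_trivial]
    exact ((G.isSymm_degMatrix (R := ℝ)).add (G.isSymm_adjMatrix (α := ℝ))).eq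
  have hset : {μ : ℝ | Module.End.HasEigenvalue (Matrix.toLin' (signlessLaplacian G)) μ}
      = Set.range hQ.eigenvalues := by
    rw [← hQ.spectrum_real_eq_range_eigenvalues]
    ext μ
    rw [Set.mem_ofPred_eq, Module.End.hasEigenvalue_iff_mem_spectrum, Matrix.spectrum_toLin']
  have hq : qMin G
      = sInf {μ : ℝ | Module.End.HasEigenvalue (Matrix.toLin' (signlessLaplacian G)) μ} := by
    unfold qMin
    congr!
  rw [hq, hset]
  have hne : (Set.range hQ.eigenvalues).Nonempty := Set.range_nonempty _
  have hfin : (Set.range hQ.eigenvalues).Finite := Set.finite_range _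
  exact ⟨hne.csInf_mem hfin, fun _ h => csInf_le hfin.bddBelow h⟩

/-- `S` is a dominating set of `G`: every vertex outside `S` is adjacent to a vertex of `S`. -/
def IsDominatingSet {W : Type*} (G : SimpleGraph W) (S : Finset W) : Prop :=
  ∀ v, v ∉ S → ∃ u ∈ S, G.Adj v u

/-- The domination number: the minimum cardinality of a dominating set (the whole vertex set
is one, so on a finite graph the minimum is attained). -/
noncomputable def dominationNumber {W : Type*} [Fintype W] (G : SimpleGraph W) : ℕ :=
  sInf {m : ℕ | ∃ S : Finset W, IsDominatingSet G S ∧ S.card = m}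

/-- `G` belongs to the class of connected non-bipartite graphs of order `n` with domination
number `γ`. -/
def IsConnNonbipDom {W : Type*} [Fintype W] (n γ : ℕ) (G : SimpleGraph W) : Prop :=
  Fintype.card W = n ∧ G.Connected ∧ ¬ G.IsBipartite ∧ dominationNumber G = γ

/-- The graph `U_n^k(g)`, meant for `3 ≤ g < n` and `1 ≤ k ≤ n - g`, on the vertices
`0, …, n - 1`. The cycle `C_g` is on `0, …, g - 1`; the path `P_l`, `l = n + 1 - g - k`, is on
`g - 1, g, …, n - k - 1`, from the vertex `g - 1` of the cycle to the centre `n - k - 1` of the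
star `S_{1,k}` (the two coincide if `l = 1`); the leaves of the star are `n - k, …, n - 1`.
The relation lists the edges `i j` with `i < j`. -/
def graphU (n k g : ℕ) : SimpleGraph (Fin n) :=
  SimpleGraph.fromRel fun i j : Fin n =>
    (j.val < g ∧ (i.val + 1 = j.val ∨ (i.val = 0 ∧ j.val + 1 = g))) ∨
    (g ≤ j.val ∧ j.val + k < n ∧ i.val + 1 = j.val) ∨
    (g ≤ j.val ∧ n ≤ j.val + k ∧ i.val + k + 1 = n)

/-- The least `k` among the graphs `U_n^k(g)`, `1 ≤ k ≤ n - g`, with domination number `γ`. -/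
noncomputable def minPendant (n γ g : ℕ) : ℕ :=
  sInf {k : ℕ | 1 ≤ k ∧ g + k ≤ n ∧ dominationNumber (graphU n k g) = γ}

/-- The graph `V_n^γ(g)`: among the graphs `U_n^k(g)` with domination number `γ`, the one with
the least `k`. -/
noncomputable def graphV (n γ g : ℕ) : SimpleGraph (Fin n) :=
  graphU n (minPendant n γ g) g

/-! Let `G` be in the class, `x` an eigenvector for `qMin G`, and `D` a minimum dominating set.
Joining the vertices of `D` one at a time costs at most two further vertices each, so `D` lies in a
connected set of at most `3γ - 2` vertices. The ends of one suitable edge make this set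
non-bipartite, and padding gives a connected non-bipartite core of exactly `m = min (3γ) n` vertices
to which every other vertex is adjacent (`exists_core`).

Number the core by increasing `|x|`. An edge `p < q` contributes at least `(|x q| - |x p|) ^ 2`,
which dominates the sum of the squared increments of `|x|` between `p` and `q`. Every cut of the
core is crossed, so the edges jointly pay for a path through the sorted vertices from `2` upwards.
What remains is `x` clipped at `|x 2|`: all vertices from `2` on now have the same absolute value,
and non-bipartiteness forces the clipped form to be at least that of a triangle on `|x 0|`, `|x 1|`,
`|x 2|` (`sum_clipSq_ge`). A vertex outside the core is hung on the last core vertex, keeping its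
difference to its old neighbour; this can only increase its entry. The resulting vector has norm at
least that of `x` and form at most that of `x`, and its form is the one of a triangle with a path
and a star (`pathStarForm_le_signlessForm`). Hence `qMin` cannot be smaller for `G`.

If equality holds, the new vector is a minimizer, and its eigenvalue equations make it strictly
increasing along the path and towards the leaves (`strictMono_of_minimizer`). Then any edge outside
the extremal graph would make one of the edge estimates strict, while no edge of that graph can be
spared by a connected non-bipartite graph.

For the odd cycle, both graphs are a Hamiltonian path plus one edge at its end `0`. A `qMin`
eigenvector of the cycle can be chosen antisymmetric under a reflection exchanging `0` and `n - 3`;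
replacing the edge `0, n - 1` by `0, n - 3` then strictly lowers the form. -/

/-! ### Quadratic forms in vertex numberings. -/

open Classical in
/-- The pairs `p < q` below `n` related by `A`. -/
noncomputable def edgePairs (A : ℕ → ℕ → Prop) (n : ℕ) : Finset (ℕ × ℕ) :=
  (Finset.range n ×ˢ Finset.range n).filter fun e => e.1 < e.2 ∧ A e.1 e.2

theorem mem_edgePairs {A : ℕ → ℕ → Prop} {n : ℕ} {e : ℕ × ℕ} :
    e ∈ edgePairs A n ↔ e.1 < e.2 ∧ e.2 < n ∧ A e.1 e.2 := by
  simp only [edgePairs, Finset.mem_filter, Finset.mem_product, Finset.mem_range]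
  constructor
  · rintro ⟨⟨_, h⟩, h1, h2⟩; exact ⟨h1, h, h2⟩
  · rintro ⟨h1, h, h2⟩; exact ⟨⟨h1.trans h, h⟩, h1, h2⟩

/-- The signless Laplacian form of the graph on `0, …, n - 1` with edges `p < q`, `A p q`. -/
noncomputable def signlessForm (A : ℕ → ℕ → Prop) (n : ℕ) (x : ℕ → ℝ) : ℝ :=
  ∑ e ∈ edgePairs A n, (x e.1 + x e.2) ^ 2

/-- The signless Laplacian form of a triangle with a path and a star, after a change of signs
which makes all edges but one of the triangle negative. -/
noncomputable def pathStarForm (c n : ℕ) (b : ℕ → ℝ) : ℝ :=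
  (b 0 + b 1) ^ 2 + (b 2 - b 0) ^ 2 + (b 2 - b 1) ^ 2 +
    ∑ j ∈ Finset.Ico 3 n, (b j - b (min (j - 1) c)) ^ 2

/-! ### Estimates for a single edge: increments and clipping. -/

/-- Increments of a monotone sequence are nonnegative, hence so are the cross terms in the square of
their sum. -/
theorem sum_sq_sub_le {a : ℕ → ℝ} {m r : ℕ} (ha : ∀ i j, i ≤ j → j < m → a i ≤ a j) :
    ∀ q, r ≤ q → q < m → ∑ i ∈ Finset.Ioc r q, (a i - a (i - 1)) ^ 2 ≤ (a q - a r) ^ 2 := by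
  intro q hq
  induction q, hq using Nat.le_induction with
  | base => simp
  | succ q hq ih =>
    intro hm
    rw [Finset.sum_Ioc_succ_top (by omega)]
    have h1 := ih (by omega)
    have h2 := ha r q hq (by omega)
    have h3 := ha q (q + 1) (by omega) hm
    simp only [Nat.add_sub_cancel]
    nlinarith [mul_nonneg (sub_nonneg.2 h2) (sub_nonneg.2 h3)]

/-- At least two increments occur and they are positive, so some cross term is positive. -/
theorem sum_sq_sub_lt {a : ℕ → ℝ} {m r q : ℕ} (ha : ∀ i j, i ≤ j → j < m → a i ≤ a j)
    (hlt : ∀ i, 3 ≤ i → i < m → a (i - 1) < a i) (hr : 2 ≤ r) (hq : r + 1 < q) (hm : q < m) :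
    ∑ i ∈ Finset.Ioc r q, (a i - a (i - 1)) ^ 2 < (a q - a r) ^ 2 := by
  obtain ⟨q, rfl⟩ : ∃ q', q = q' + 1 := ⟨q - 1, by omega⟩
  rw [Finset.sum_Ioc_succ_top (by omega)]
  have h1 := sum_sq_sub_le (r := r) ha q (by omega) (by omega)
  have h2 : a r < a q :=
    (ha r (q - 1) (by omega) (by omega)).trans_lt (hlt q (by omega) (by omega))
  have h3 := hlt (q + 1) (by omega) hm
  simp only [Nat.add_sub_cancel] at h3 ⊢
  nlinarith [mul_pos (sub_pos.2 h2) (sub_pos.2 h3)]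

open Classical in
/-- The value of `(x p + x q) ^ 2` after the absolute values have been cut off at `s`. -/
noncomputable def clipSq (x : ℕ → ℝ) (s : ℝ) (p q : ℕ) : ℝ :=
  if (0 ≤ x p ↔ 0 ≤ x q) then (min |x p| s + min |x q| s) ^ 2
  else (min |x p| s - min |x q| s) ^ 2

theorem clipSq_nonneg (x : ℕ → ℝ) (s : ℝ) (p q : ℕ) : 0 ≤ clipSq x s p q := by
  unfold clipSq; split_ifs <;> positivity

theorem add_sq_of_same_sign {u v : ℝ} (h : 0 ≤ u ↔ 0 ≤ v) : (u + v) ^ 2 = (|u| + |v|) ^ 2 := by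
  by_cases hu : 0 ≤ u
  · rw [abs_of_nonneg hu, abs_of_nonneg (h.1 hu)]
  · have hv : ¬ 0 ≤ v := fun hv => hu (h.2 hv)
    rw [abs_of_neg (not_le.1 hu), abs_of_neg (not_le.1 hv)]; ring

theorem add_sq_of_opp_sign {u v : ℝ} (h : ¬ (0 ≤ u ↔ 0 ≤ v)) :
    (u + v) ^ 2 = (|u| - |v|) ^ 2 := by
  by_cases hu : 0 ≤ u
  · have hv : ¬ 0 ≤ v := fun hv => h (by simp [hu, hv])
    rw [abs_of_nonneg hu, abs_of_neg (not_le.1 hv)]; ring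
  · have hv : 0 ≤ v := by by_contra hv; exact h (by simp [hu, hv])
    rw [abs_of_neg (not_le.1 hu), abs_of_nonneg hv]; ring

theorem abs_sub_sq_le_add_sq (u v : ℝ) : (|v| - |u|) ^ 2 ≤ (u + v) ^ 2 := by
  by_cases h : (0 ≤ u ↔ 0 ≤ v)
  · rw [add_sq_of_same_sign h]
    nlinarith [mul_nonneg (abs_nonneg u) (abs_nonneg v)]
  · rw [add_sq_of_opp_sign h]; apply le_of_eq; ring

/-- The part of the form at an edge `p < q` which pays for the cuts between `i - 1` and `i`. -/
noncomputable def cutSum (x : ℕ → ℝ) (m p q : ℕ) : ℝ :=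
  ∑ i ∈ Finset.Ico 3 m, if p < i ∧ i ≤ q then (|x i| - |x (i - 1)|) ^ 2 else 0

theorem cutSum_eq {x : ℕ → ℝ} {m p q : ℕ} (hq : q < m) :
    cutSum x m p q = ∑ i ∈ Finset.Ioc (max p 2) q, (|x i| - |x (i - 1)|) ^ 2 := by
  rw [cutSum, ← Finset.sum_filter]
  congr 1
  ext i
  simp only [Finset.mem_filter, Finset.mem_Ico, Finset.mem_Ioc]
  omega

/-- The signed difference or sum of the absolute values splits into a clipped part, at level at most
`|x 2|`, and a part above that level. The square of the whole is at least the sum of the two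
squares, and the upper part pays for its increments by `sum_sq_sub_le`. -/
theorem cutSum_add_clipSq_le {x : ℕ → ℝ} {m p q : ℕ}
    (hm : 3 ≤ m) (ha : ∀ i j, i ≤ j → j < m → |x i| ≤ |x j|) (hpq : p < q) (hq : q < m) :
    cutSum x m p q + clipSq x |x 2| p q ≤ (x p + x q) ^ 2 := by
  rw [cutSum_eq hq]
  have hp0 := abs_nonneg (x p)
  have h20 := abs_nonneg (x 2)
  rcases Nat.lt_or_ge 2 q with h2q | h2q
  · have hs := sum_sq_sub_le (a := fun i => |x i|) (r := max p 2) ha q (by omega) hq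
    have h2q' : |x 2| ≤ |x q| := ha 2 q h2q.le hq
    rcases Nat.lt_or_ge p 2 with hp | hp
    · have hp2 : |x p| ≤ |x 2| := ha p 2 hp.le (by omega)
      rw [max_eq_right hp.le] at hs ⊢
      rw [clipSq, min_eq_left hp2, min_eq_right h2q']
      split_ifs with h
      · rw [add_sq_of_same_sign h]
        nlinarith [mul_nonneg (sub_nonneg.2 h2q') (add_nonneg h20 hp0)]
      · rw [add_sq_of_opp_sign h]
        nlinarith [mul_nonneg (sub_nonneg.2 h2q') (sub_nonneg.2 hp2)]
    · have hp2 : |x 2| ≤ |x p| := ha 2 p hp (by omega)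
      rw [max_eq_left hp] at hs ⊢
      rw [clipSq, min_eq_right hp2, min_eq_right h2q']
      split_ifs with h
      · rw [add_sq_of_same_sign h]
        nlinarith [mul_le_mul hp2 h2q' h20 hp0]
      · rw [add_sq_of_opp_sign h]
        nlinarith
  · rw [Finset.Ioc_eq_empty (by omega), Finset.sum_empty, zero_add, clipSq,
      min_eq_left (ha p 2 (by omega) (by omega)), min_eq_left (ha q 2 (by omega) (by omega))]
    split_ifs with h
    · rw [add_sq_of_same_sign h]
    · rw [add_sq_of_opp_sign h]

/-- The edge either starts below `2`, where the cross term between clipped and upper part is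
positive, or skips a vertex above `2`, where `sum_sq_sub_lt` applies. This excludes such edges in
the case of equality. -/
theorem cutSum_add_clipSq_lt {x : ℕ → ℝ} {m p q : ℕ}
    (ha : ∀ i j, i ≤ j → j < m → |x i| ≤ |x j|) (hlt : ∀ i, 2 ≤ i → i < m → |x (i - 1)| < |x i|)
    (hpq : p + 1 < q) (h3 : 3 ≤ q) (hq : q < m) :
    cutSum x m p q + clipSq x |x 2| p q < (x p + x q) ^ 2 := by
  rw [cutSum_eq hq]
  have hp0 := abs_nonneg (x p)
  have h20 : 0 < |x 2| := (abs_nonneg _).trans_lt (hlt 2 le_rfl (by omega))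
  have h2q' : |x 2| < |x q| :=
    (ha 2 (q - 1) (by omega) (by omega)).trans_lt (hlt q (by omega) hq)
  rcases Nat.lt_or_ge p 2 with hp | hp
  · have hs := sum_sq_sub_le (a := fun i => |x i|) (r := max p 2) ha q (by omega) hq
    have hp2 : |x p| < |x 2| := (ha p 1 (by omega) (by omega)).trans_lt (hlt 2 le_rfl (by omega))
    rw [max_eq_right hp.le] at hs ⊢
    rw [clipSq, min_eq_left hp2.le, min_eq_right h2q'.le]
    split_ifs with h
    · rw [add_sq_of_same_sign h]
      nlinarith [mul_pos (sub_pos.2 h2q') (add_pos_of_pos_of_nonneg h20 hp0)]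
    · rw [add_sq_of_opp_sign h]
      nlinarith [mul_pos (sub_pos.2 h2q') (sub_pos.2 hp2)]
  · have hs := sum_sq_sub_lt (a := fun i => |x i|) (r := p) ha
      (fun i hi => hlt i (by omega)) hp hpq hq
    have hp2 : |x 2| ≤ |x p| := ha 2 p hp (by omega)
    rw [max_eq_left hp]
    rw [clipSq, min_eq_right hp2, min_eq_right h2q'.le]
    split_ifs with h
    · rw [add_sq_of_same_sign h]
      nlinarith [mul_le_mul hp2 h2q'.le h20.le hp0]
    · rw [add_sq_of_opp_sign h]
      nlinarith

/-- After exchanging the sums, the increment at `i` is charged to a single edge crossing the cut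
between `i - 1` and `i`. -/
theorem sum_cutSum_ge {A : ℕ → ℕ → Prop} {m : ℕ} (x : ℕ → ℝ)
    (hcut : ∀ i, 0 < i → i < m → ∃ u v, u < i ∧ i ≤ v ∧ v < m ∧ A u v) :
    ∑ i ∈ Finset.Ico 3 m, (|x i| - |x (i - 1)|) ^ 2 ≤
      ∑ e ∈ edgePairs A m, cutSum x m e.1 e.2 := by
  unfold cutSum
  rw [Finset.sum_comm]
  refine Finset.sum_le_sum fun i hi => ?_
  rw [Finset.mem_Ico] at hi
  obtain ⟨u, v, hu, hv, hvm, huv⟩ := hcut i (by omega) hi.2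
  have hmem : (u, v) ∈ edgePairs A m := mem_edgePairs.2 ⟨by simp; omega, hvm, huv⟩
  refine le_trans ?_ (Finset.single_le_sum (fun e _ => ?_) hmem)
  · simp [hu, hv]
  · split_ifs <;> positivity

/-! ### The triangle obtained from an odd closed walk. -/

/-- If no two-colouring is proper, then one of three local configurations at the vertices `0`, `1`
shows that the signs `σ`, even after a change at `0` and `1`, do not alternate along all edges. -/
theorem exists_odd_pattern {A : ℕ → ℕ → Prop} {m : ℕ} (σ : ℕ → Prop)
    (hodd : ∀ c : ℕ → Prop, ∃ u v, u < v ∧ v < m ∧ A u v ∧ (c u ↔ c v)) :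
    (∃ p q, 2 ≤ p ∧ p < q ∧ q < m ∧ A p q ∧ (σ p ↔ σ q)) ∨
    (∃ w q q', w < 2 ∧ 2 ≤ q ∧ q < m ∧ 2 ≤ q' ∧ q' < m ∧ A w q ∧ A w q' ∧
      (σ w ↔ σ q) ∧ ¬ (σ w ↔ σ q')) ∨
    (∃ q q', 2 ≤ q ∧ q < m ∧ 2 ≤ q' ∧ q' < m ∧ A 0 1 ∧ A 0 q ∧ A 1 q' ∧
      ((σ 0 ↔ σ 1) ↔ ((σ 0 ↔ σ q) ↔ (σ 1 ↔ σ q')))) := by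
  by_contra! hcon
  obtain ⟨hA, hB, hC⟩ := hcon
  -- Without the second configuration, all edges from `w` to vertices `≥ 2` have equal type; `t`
  -- says that they join equal signs.
  have ht : ∀ w, w < 2 → ∃ t : Prop, ∀ q, 2 ≤ q → q < m → A w q →
      ((σ w ↔ σ q) ↔ t) := by
    intro w hw
    refine ⟨∃ q, 2 ≤ q ∧ q < m ∧ A w q ∧ (σ w ↔ σ q), fun q h1 h2 h3 =>
      ⟨fun h => ⟨q, h1, h2, h3, h⟩, ?_⟩⟩
    rintro ⟨q', h1', h2', h3', h'⟩
    exact hB w q' q hw h1' h2' h1 h2 h3' h3 h'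
  have key : ∃ t0 t1 : Prop,
      (∀ q, 2 ≤ q → q < m → A 0 q → ((σ 0 ↔ σ q) ↔ t0)) ∧
      (∀ q, 2 ≤ q → q < m → A 1 q → ((σ 1 ↔ σ q) ↔ t1)) ∧
      (A 0 1 → ¬ ((σ 0 ↔ σ 1) ↔ (t0 ↔ t1))) := by
    obtain ⟨t0, h0⟩ := ht 0 (by omega)
    obtain ⟨t1, h1⟩ := ht 1 (by omega)
    -- If `0` or `1` has no neighbour `≥ 2`, its `t` is unconstrained and can be chosen to make the
    -- edge `0 1` alternate as well.
    by_cases e0 : ∃ q, 2 ≤ q ∧ q < m ∧ A 0 q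
    · by_cases e1 : ∃ q, 2 ≤ q ∧ q < m ∧ A 1 q
      · obtain ⟨q, hq, hqm, hAq⟩ := e0
        obtain ⟨q', hq', hqm', hAq'⟩ := e1
        refine ⟨t0, t1, h0, h1, fun h01 hcon => ?_⟩
        have := hC q q' hq hqm hq' hqm' h01 hAq hAq'
        rw [h0 q hq hqm hAq, h1 q' hq' hqm' hAq'] at this
        grind
      · refine ⟨t0, ¬ ((σ 0 ↔ σ 1) ↔ t0), h0,
          fun q a b c => absurd ⟨q, a, b, c⟩ e1, fun _ => by grind⟩
    · refine ⟨¬ ((σ 0 ↔ σ 1) ↔ t1), t1, fun q a b c => absurd ⟨q, a, b, c⟩ e0, h1,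
        fun _ => by grind⟩
  obtain ⟨t0, t1, h0, h1, h2⟩ := key
  -- These are the signs `σ`, reversed at `0` if `t0` and at `1` if `t1`; they form a proper
  -- colouring, a contradiction.
  obtain ⟨u, v, huv, hv, hAuv, hc⟩ := hodd fun v =>
    (v = 0 ∧ (σ 0 ↔ ¬ t0)) ∨ (v = 1 ∧ (σ 1 ↔ ¬ t1)) ∨ (2 ≤ v ∧ σ v)
  rcases Nat.lt_or_ge u 2 with hu | hu
  · rcases Nat.lt_or_ge v 2 with hv2 | hv2
    · obtain rfl : u = 0 := by omega
      obtain rfl : v = 1 := by omega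
      have := h2 hAuv
      simp at hc
      grind
    · have hv0 : v ≠ 0 := by omega
      have hv1 : v ≠ 1 := by omega
      have : u = 0 ∨ u = 1 := by omega
      rcases this with rfl | rfl
      · have := h0 v hv2 hv hAuv
        simp [hv0, hv1, hv2] at hc
        grind
      · have := h1 v hv2 hv hAuv
        simp [hv0, hv1, hv2] at hc
        grind
  · have := hA u v hu huv hv hAuv
    have hv0 : v ≠ 0 := by omega
    have hv1 : v ≠ 1 := by omega
    have hu0 : u ≠ 0 := by omega
    have hu1 : u ≠ 1 := by omega
    have hv2 : 2 ≤ v := by omega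
    simp [hv0, hv1, hu0, hu1, hu, hv2] at hc
    grind

/-- Write `a ≤ b ≤ s` for the three smallest absolute values. Each pattern of `exists_odd_pattern`
already pays for the triangle: an edge with equal signs at height `s` gives `4 s ^ 2`; a low vertex
of value `w` with edges of both types gives `(s + w) ^ 2 + (s - w) ^ 2`; the last pattern is a
triangle with an odd number of edges joining equal signs, cheapest when this is only the edge `0 1`.
-/
theorem sum_clipSq_ge {A : ℕ → ℕ → Prop} {m : ℕ} {x : ℕ → ℝ} (hm : 3 ≤ m)
    (ha : ∀ i j, i ≤ j → j < m → |x i| ≤ |x j|)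
    (hodd : ∀ c : ℕ → Prop, ∃ u v, u < v ∧ v < m ∧ A u v ∧ (c u ↔ c v)) :
    (|x 0| + |x 1|) ^ 2 + (|x 2| - |x 0|) ^ 2 + (|x 2| - |x 1|) ^ 2 ≤
      ∑ e ∈ edgePairs A m, clipSq x |x 2| e.1 e.2 := by
  have h00 := abs_nonneg (x 0)
  have h01 : |x 0| ≤ |x 1| := ha 0 1 (by omega) (by omega)
  have h12 : |x 1| ≤ |x 2| := ha 1 2 (by omega) (by omega)
  have hsub : ∀ S : Finset (ℕ × ℕ), S ⊆ edgePairs A m →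
      ∑ e ∈ S, clipSq x |x 2| e.1 e.2 ≤ ∑ e ∈ edgePairs A m, clipSq x |x 2| e.1 e.2 :=
    fun S hS => Finset.sum_le_sum_of_subset_of_nonneg hS fun _ _ _ => clipSq_nonneg _ _ _ _
  have hhigh : ∀ q, 2 ≤ q → q < m → min |x q| |x 2| = |x 2| := fun q h h' =>
    min_eq_right (ha 2 q h h')
  have hlow : ∀ q, q ≤ 2 → min |x q| |x 2| = |x q| := fun q h => min_eq_left (ha q 2 h (by omega))
  by_cases hA : ∃ p q, 2 ≤ p ∧ p < q ∧ q < m ∧ A p q ∧ (0 ≤ x p ↔ 0 ≤ x q)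
  · obtain ⟨p, q, hp, hpq, hq, hApq, hT⟩ := hA
    refine le_trans ?_ (hsub {(p, q)} (by simpa [mem_edgePairs] using ⟨hpq, hq, hApq⟩))
    rw [Finset.sum_singleton, clipSq, if_pos hT, hhigh p hp (by omega), hhigh q (by omega) hq]
    nlinarith [mul_nonneg (sub_nonneg.2 h12) (sub_nonneg.2 (h01.trans h12)),
      mul_nonneg h00 (sub_nonneg.2 h12), mul_nonneg h00 (sub_nonneg.2 h01),
      mul_nonneg (h00.trans h01) (sub_nonneg.2 h12)]
  by_cases hB : ∃ w q q', w < 2 ∧ 2 ≤ q ∧ q < m ∧ 2 ≤ q' ∧ q' < m ∧ A w q ∧ A w q' ∧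
      (0 ≤ x w ↔ 0 ≤ x q) ∧ ¬ (0 ≤ x w ↔ 0 ≤ x q')
  · obtain ⟨w, q, q', hw, hq, hqm, hq', hqm', hAq, hAq', hT, hT'⟩ := hB
    have hne : q ≠ q' := by rintro rfl; exact hT' hT
    refine le_trans ?_ (hsub {(w, q), (w, q')} ?_)
    · rw [Finset.sum_pair (by simpa using hne), clipSq, clipSq, if_pos hT, if_neg hT',
        hhigh q hq hqm, hhigh q' hq' hqm', hlow w (by omega)]
      have : w = 0 ∨ w = 1 := by omega
      rcases this with rfl | rfl
      · nlinarith [mul_nonneg h00 (sub_nonneg.2 h12), mul_nonneg (h00.trans h01) (sub_nonneg.2 h12)]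
      · nlinarith [mul_nonneg h00 (sub_nonneg.2 h12), mul_nonneg h00 (sub_nonneg.2 h01),
          mul_nonneg (h00.trans h01) (sub_nonneg.2 h12)]
    · intro e he
      simp only [Finset.mem_insert, Finset.mem_singleton] at he
      rcases he with rfl | rfl
      · exact mem_edgePairs.2 ⟨by simp; omega, hqm, hAq⟩
      · exact mem_edgePairs.2 ⟨by simp; omega, hqm', hAq'⟩
  by_cases hC : ∃ q q', 2 ≤ q ∧ q < m ∧ 2 ≤ q' ∧ q' < m ∧ A 0 1 ∧ A 0 q ∧ A 1 q' ∧
      ((0 ≤ x 0 ↔ 0 ≤ x 1) ↔ ((0 ≤ x 0 ↔ 0 ≤ x q) ↔ (0 ≤ x 1 ↔ 0 ≤ x q')))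
  · obtain ⟨q, q', hq, hqm, hq', hqm', hA01, hAq, hAq', hT⟩ := hC
    refine le_trans ?_ (hsub {(0, 1), (0, q), (1, q')} ?_)
    · rw [Finset.sum_insert (by simp; omega), Finset.sum_pair (by simp)]
      simp only [clipSq, hhigh q hq hqm, hhigh q' hq' hqm', hlow 0 (by omega), hlow 1 (by omega)]
      split_ifs with h1 h2 h3 h3 h2 h3 h3
      · nlinarith [mul_nonneg h00 (h00.trans (h01.trans h12)),
          mul_nonneg (h00.trans h01) (h00.trans (h01.trans h12))]
      · tauto
      · tauto
      · apply le_of_eq; ring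
      · tauto
      · nlinarith [mul_nonneg h00 (sub_nonneg.2 h12)]
      · nlinarith [mul_nonneg (h00.trans h01) (sub_nonneg.2 (h01.trans h12))]
      · tauto
    · intro e he
      simp only [Finset.mem_insert, Finset.mem_singleton] at he
      rcases he with rfl | rfl | rfl
      · exact mem_edgePairs.2 ⟨by simp, by simp; omega, hA01⟩
      · exact mem_edgePairs.2 ⟨by simp; omega, hqm, hAq⟩
      · exact mem_edgePairs.2 ⟨by simp; omega, hqm', hAq'⟩
  exact absurd (exists_odd_pattern (fun v => 0 ≤ x v) hodd) (by simp only [not_or]; exact ⟨hA, hB, hC⟩)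

/-! ### The folded vector, comparison of forms and the case of equality. -/

/-- The vector with entries `|x j|` on the core `j < m` whose entries at the vertices `j ≥ m`
differ from the one at `m - 1` as `|x j|` differs from its value at the neighbour `f j`. -/
noncomputable def foldVector (x : ℕ → ℝ) (m : ℕ) (f : ℕ → ℕ) (j : ℕ) : ℝ :=
  if j < m then |x j| else |x (m - 1)| + |(|x j| - |x (f j)|)|

/-- The share of the form `pathStarForm` paid for by an edge. -/
noncomputable def edgeWeight (x : ℕ → ℝ) (m : ℕ) (f : ℕ → ℕ) (e : ℕ × ℕ) : ℝ :=
  if e.2 < m then cutSum x m e.1 e.2 + clipSq x |x 2| e.1 e.2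
  else if e.1 = f e.2 then (|x e.2| - |x (f e.2)|) ^ 2 else 0

theorem edgeWeight_le {A : ℕ → ℕ → Prop} {n m : ℕ} {x : ℕ → ℝ} (f : ℕ → ℕ) (hm : 3 ≤ m)
    (ha : ∀ i j, i ≤ j → j < m → |x i| ≤ |x j|) {e : ℕ × ℕ} (he : e ∈ edgePairs A n) :
    edgeWeight x m f e ≤ (x e.1 + x e.2) ^ 2 := by
  obtain ⟨h1, h2, h3⟩ := mem_edgePairs.1 he
  unfold edgeWeight
  split_ifs with h4 h5
  · exact cutSum_add_clipSq_le hm ha h1 h4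
  · rw [← h5]; exact abs_sub_sq_le_add_sq _ _
  · positivity

theorem edgePairs_core {A : ℕ → ℕ → Prop} {n m : ℕ} (hmn : m ≤ n) :
    (edgePairs A n).filter (fun e => e.2 < m) = edgePairs A m := by
  ext e
  simp only [Finset.mem_filter, mem_edgePairs]
  constructor
  · rintro ⟨⟨h1, _, h3⟩, h⟩; exact ⟨h1, h, h3⟩
  · rintro ⟨h1, h, h3⟩; exact ⟨⟨h1, by omega, h3⟩, h⟩

/-- The alternatives in `hc` are: the core ends at the star centre `c` and the remaining vertices
are the leaves; or the core is everything, and the only leaf `c + 1` merely prolongs the path. -/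
theorem pathStarForm_foldVector {n m c : ℕ} (x : ℕ → ℝ) (f : ℕ → ℕ) (hm : 3 ≤ m) (hmn : m ≤ n)
    (hc : m = c + 1 ∨ (m = n ∧ n = c + 2)) :
    pathStarForm c n (foldVector x m f) =
      (|x 0| + |x 1|) ^ 2 + (|x 2| - |x 0|) ^ 2 + (|x 2| - |x 1|) ^ 2 +
        ∑ i ∈ Finset.Ico 3 m, (|x i| - |x (i - 1)|) ^ 2 +
        ∑ j ∈ Finset.Ico m n, (|x j| - |x (f j)|) ^ 2 := by
  unfold pathStarForm
  rw [← Finset.sum_Ico_consecutive _ hm hmn]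
  have h1 : ∑ j ∈ Finset.Ico 3 m,
      (foldVector x m f j - foldVector x m f (min (j - 1) c)) ^ 2 =
      ∑ i ∈ Finset.Ico 3 m, (|x i| - |x (i - 1)|) ^ 2 := by
    refine Finset.sum_congr rfl fun j hj => ?_
    rw [Finset.mem_Ico] at hj
    rw [min_eq_left (by omega), foldVector, foldVector, if_pos hj.2, if_pos (by omega)]
  have h2 : ∑ j ∈ Finset.Ico m n,
      (foldVector x m f j - foldVector x m f (min (j - 1) c)) ^ 2 =
      ∑ j ∈ Finset.Ico m n, (|x j| - |x (f j)|) ^ 2 := by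
    refine Finset.sum_congr rfl fun j hj => ?_
    rw [Finset.mem_Ico] at hj
    rw [show min (j - 1) c = m - 1 by omega, foldVector, foldVector, if_neg (by omega),
      if_pos (by omega), add_sub_cancel_left, sq_abs]
  rw [h1, h2, foldVector, foldVector, foldVector, if_pos (by omega), if_pos (by omega),
    if_pos (by omega)]
  ring

theorem pathStarForm_le_sum_edgeWeight {A : ℕ → ℕ → Prop} {n m c : ℕ} {x : ℕ → ℝ} {f : ℕ → ℕ}
    (hm : 3 ≤ m) (hmn : m ≤ n) (hc : m = c + 1 ∨ (m = n ∧ n = c + 2))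
    (ha : ∀ i j, i ≤ j → j < m → |x i| ≤ |x j|)
    (hcut : ∀ i, 0 < i → i < m → ∃ u v, u < i ∧ i ≤ v ∧ v < m ∧ A u v)
    (hodd : ∀ c : ℕ → Prop, ∃ u v, u < v ∧ v < m ∧ A u v ∧ (c u ↔ c v))
    (hf : ∀ j, m ≤ j → j < n → f j < m ∧ A (f j) j) :
    pathStarForm c n (foldVector x m f) ≤ ∑ e ∈ edgePairs A n, edgeWeight x m f e := by
  rw [pathStarForm_foldVector x f hm hmn hc,
    ← Finset.sum_filter_add_sum_filter_not (edgePairs A n) (fun e => e.2 < m), edgePairs_core hmn]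
  have h1 : ∑ e ∈ edgePairs A m, edgeWeight x m f e =
      ∑ e ∈ edgePairs A m, cutSum x m e.1 e.2 +
        ∑ e ∈ edgePairs A m, clipSq x |x 2| e.1 e.2 := by
    rw [← Finset.sum_add_distrib]
    exact Finset.sum_congr rfl fun e he => if_pos (mem_edgePairs.1 he).2.1
  have h2 : ∑ j ∈ Finset.Ico m n, (|x j| - |x (f j)|) ^ 2 ≤
      ∑ e ∈ (edgePairs A n).filter (fun e => ¬ e.2 < m), edgeWeight x m f e := by
    have : ∑ j ∈ Finset.Ico m n, (|x j| - |x (f j)|) ^ 2 =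
        ∑ e ∈ (Finset.Ico m n).image (fun j => (f j, j)), edgeWeight x m f e := by
      rw [Finset.sum_image (by intro i _ j _ h; simpa using (Prod.ext_iff.1 h).2)]
      refine Finset.sum_congr rfl fun j hj => ?_
      rw [Finset.mem_Ico] at hj
      simp [edgeWeight, hj.1]
    rw [this]
    refine Finset.sum_le_sum_of_subset_of_nonneg ?_ ?_
    · intro e he
      obtain ⟨j, hj, rfl⟩ := Finset.mem_image.1 he
      rw [Finset.mem_Ico] at hj
      obtain ⟨h3, h4⟩ := hf j hj.1 hj.2
      simp only [Finset.mem_filter, mem_edgePairs]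
      exact ⟨⟨by omega, hj.2, h4⟩, by omega⟩
    · intro e he _
      rw [edgeWeight, if_neg (Finset.mem_filter.1 he).2]
      split_ifs <;> positivity
  have h3 := sum_cutSum_ge x hcut
  have h4 := sum_clipSq_ge hm ha hodd
  linarith

/-- A connected non-bipartite graph on `m` vertices with further vertices attached to it has a form
no smaller than the one of a triangle with a path and a star. -/
theorem pathStarForm_le_signlessForm {A : ℕ → ℕ → Prop} {n m c : ℕ} {x : ℕ → ℝ} {f : ℕ → ℕ}
    (hm : 3 ≤ m) (hmn : m ≤ n) (hc : m = c + 1 ∨ (m = n ∧ n = c + 2))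
    (ha : ∀ i j, i ≤ j → j < m → |x i| ≤ |x j|)
    (hcut : ∀ i, 0 < i → i < m → ∃ u v, u < i ∧ i ≤ v ∧ v < m ∧ A u v)
    (hodd : ∀ c : ℕ → Prop, ∃ u v, u < v ∧ v < m ∧ A u v ∧ (c u ↔ c v))
    (hf : ∀ j, m ≤ j → j < n → f j < m ∧ A (f j) j) :
    pathStarForm c n (foldVector x m f) ≤ signlessForm A n x :=
  (pathStarForm_le_sum_edgeWeight hm hmn hc ha hcut hodd hf).trans
    (Finset.sum_le_sum fun _ he => edgeWeight_le f hm ha he)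

/-- The neighbour `f j` lies in the core, whose largest entry is at `m - 1`. Hence folding does not
decrease the norm. -/
theorem le_foldVector {m : ℕ} {x : ℕ → ℝ} {f : ℕ → ℕ} {j : ℕ}
    (ha : ∀ i j, i ≤ j → j < m → |x i| ≤ |x j|) (hf : m ≤ j → f j < m) :
    |x j| ≤ foldVector x m f j := by
  unfold foldVector
  split_ifs with h
  · exact le_rfl
  · have h1 := ha (f j) (m - 1) (by have := hf (by omega); omega) (by have := hf (by omega); omega)
    have h2 := le_abs_self (|x j| - |x (f j)|)
    linarith

/-- In the case of equality all edges of the graph belong to the triangle, the path or the star. -/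
theorem edge_of_signlessForm_le {A : ℕ → ℕ → Prop} {n m c : ℕ} {x : ℕ → ℝ} {f : ℕ → ℕ}
    (hm : 3 ≤ m) (hmn : m ≤ n) (hc : m = c + 1 ∨ (m = n ∧ n = c + 2))
    (ha : ∀ i j, i ≤ j → j < m → |x i| ≤ |x j|)
    (hcut : ∀ i, 0 < i → i < m → ∃ u v, u < i ∧ i ≤ v ∧ v < m ∧ A u v)
    (hodd : ∀ c : ℕ → Prop, ∃ u v, u < v ∧ v < m ∧ A u v ∧ (c u ↔ c v))
    (hf : ∀ j, m ≤ j → j < n → f j < m ∧ A (f j) j)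
    (hlt : ∀ i, 2 ≤ i → i < m → |x (i - 1)| < |x i|)
    (hleaf : ∀ j, m ≤ j → j < n → |x (m - 1)| < |x j|)
    (hnorm : ∀ j, m ≤ j → j < n → foldVector x m f j = |x j|)
    (heq : signlessForm A n x ≤ pathStarForm c n (foldVector x m f))
    {p q : ℕ} (hpq : p < q) (hq : q < n) (hA : A p q) : q ≤ 2 ∨ p = min (q - 1) c := by
  -- Both ends of the chain of inequalities agree, so no edge has slack.
  have htight : ∀ e ∈ edgePairs A n, (x e.1 + x e.2) ^ 2 ≤ edgeWeight x m f e := by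
    intro e he
    by_contra! hlt'
    have := Finset.sum_lt_sum (fun e he => edgeWeight_le (A := A) (n := n) f hm ha he)
      ⟨e, he, hlt'⟩
    have h2 := pathStarForm_le_sum_edgeWeight hm hmn hc ha hcut hodd hf
    unfold signlessForm at heq
    linarith
  -- Moving `j` from a neighbour with a smaller entry to `m - 1` would strictly increase its entry,
  -- against `hnorm`.
  have hfm : ∀ j, m ≤ j → j < n → f j = m - 1 := by
    intro j hj hjn
    obtain ⟨h1, h2⟩ := hf j hj hjn
    by_contra hne
    have h3 := hnorm j hj hjn
    have h4 := hleaf j hj hjn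
    have h5 : |x (f j)| < |x (m - 1)| :=
      (ha (f j) (m - 2) (by omega) (by omega)).trans_lt (hlt (m - 1) (by omega) (by omega))
    rw [foldVector, if_neg (by omega),
      abs_of_pos (show 0 < |x j| - |x (f j)| by linarith)] at h3
    linarith
  have hx2 : 0 < |x (m - 1)| := (abs_nonneg _).trans_lt (hlt (m - 1) (by omega) (by omega))
  -- Tightness of the edge from `m - 1` to `j` excludes equal signs, since both entries are nonzero.
  have hsign : ∀ j, m ≤ j → j < n → ¬ (0 ≤ x (m - 1) ↔ 0 ≤ x j) := by
    intro j hj hjn hT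
    have h1 := hf j hj hjn
    rw [hfm j hj hjn] at h1
    have h2 := htight (m - 1, j) (mem_edgePairs.2 ⟨by simp; omega, hjn, h1.2⟩)
    rw [edgeWeight, if_neg (by simpa using hj), if_pos (hfm j hj hjn).symm, hfm j hj hjn,
      add_sq_of_same_sign hT] at h2
    have h3 := hleaf j hj hjn
    simp only at h2
    nlinarith
  have h := htight (p, q) (mem_edgePairs.2 ⟨hpq, hq, hA⟩)
  rcases Nat.lt_or_ge q m with hqm | hqm
  · by_contra! hcon
    have h1 := cutSum_add_clipSq_lt ha hlt (p := p) (q := q) (by omega) (by omega) hqm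
    rw [edgeWeight, if_pos (by simpa using hqm)] at h
    exact absurd h (not_le.2 h1)
  · right
    by_contra hcon
    have hpm : p ≠ m - 1 := by omega
    rw [edgeWeight, if_neg (by simpa using hqm),
      if_neg (by simp only [hfm q hqm hq]; exact hpm)] at h
    simp only at h
    -- The edge has weight zero, so its term vanishes. This is impossible from a core vertex, whose
    -- absolute value is smaller than the leaf's, and between two leaves, which have the same
    -- nonzero sign.
    rcases Nat.lt_or_ge p m with hp | hp
    · have h1 := abs_sub_sq_le_add_sq (x p) (x q)
      have h2 := ha p (m - 1) (by omega) (by omega)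
      have h3 := hleaf q hqm hq
      nlinarith
    · have h1 := hsign p hp (by omega)
      have h2 := hsign q hqm hq
      have h3 := hleaf q hqm hq
      rw [add_sq_of_same_sign (by tauto)] at h
      nlinarith [abs_nonneg (x p)]

/-! ### Minimizers of the path-and-star form. -/

/-- The bilinear form of `pathStarForm`. -/
noncomputable def pathStarBilin (c n : ℕ) (b h : ℕ → ℝ) : ℝ :=
  (b 0 + b 1) * (h 0 + h 1) + (b 2 - b 0) * (h 2 - h 0) + (b 2 - b 1) * (h 2 - h 1) +
    ∑ j ∈ Finset.Ico 3 n, (b j - b (min (j - 1) c)) * (h j - h (min (j - 1) c))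

theorem pathStarForm_add_mul (c n : ℕ) (b h : ℕ → ℝ) (t : ℝ) :
    pathStarForm c n (fun j => b j + t * h j) =
      pathStarForm c n b + 2 * t * pathStarBilin c n b h + t ^ 2 * pathStarForm c n h := by
  have : ∑ j ∈ Finset.Ico 3 n, (b j + t * h j - (b (min (j - 1) c) + t * h (min (j - 1) c))) ^ 2 =
      ∑ j ∈ Finset.Ico 3 n, (b j - b (min (j - 1) c)) ^ 2 +
      2 * t * ∑ j ∈ Finset.Ico 3 n, (b j - b (min (j - 1) c)) * (h j - h (min (j - 1) c)) +
      t ^ 2 * ∑ j ∈ Finset.Ico 3 n, (h j - h (min (j - 1) c)) ^ 2 := by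
    rw [Finset.mul_sum, Finset.mul_sum, ← Finset.sum_add_distrib, ← Finset.sum_add_distrib]
    exact Finset.sum_congr rfl fun j _ => by ring
  unfold pathStarForm pathStarBilin
  rw [this]; ring

theorem eq_zero_of_forall_quadratic_nonneg {α β : ℝ} (h : ∀ t : ℝ, 0 ≤ 2 * t * α + t ^ 2 * β) :
    α = 0 := by
  -- The discriminant of the quadratic in `t` is `(2 * α) ^ 2`.
  have hd := discrim_le_zero (a := β) (b := 2 * α) (c := 0) fun t => by
    have := h t; nlinarith
  unfold discrim at hd
  nlinarith

/-- A minimizer of the Rayleigh quotient satisfies the eigenvalue equation. -/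
theorem pathStarBilin_eq_of_minimizer {c n : ℕ} {lam : ℝ} {b : ℕ → ℝ}
    (hmin : ∀ h, lam * ∑ j ∈ Finset.range n, h j ^ 2 ≤ pathStarForm c n h)
    (hb : pathStarForm c n b ≤ lam * ∑ j ∈ Finset.range n, b j ^ 2) (h : ℕ → ℝ) :
    pathStarBilin c n b h = lam * ∑ j ∈ Finset.range n, b j * h j := by
  rw [← sub_eq_zero]
  refine eq_zero_of_forall_quadratic_nonneg
    (β := pathStarForm c n h - lam * ∑ j ∈ Finset.range n, h j ^ 2) fun t => ?_
  have h1 := hmin fun j => b j + t * h j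
  have h2 : ∑ j ∈ Finset.range n, (b j + t * h j) ^ 2 = ∑ j ∈ Finset.range n, b j ^ 2 +
      2 * t * ∑ j ∈ Finset.range n, b j * h j + t ^ 2 * ∑ j ∈ Finset.range n, h j ^ 2 := by
    rw [Finset.mul_sum, Finset.mul_sum, ← Finset.sum_add_distrib, ← Finset.sum_add_distrib]
    exact Finset.sum_congr rfl fun j _ => by ring
  rw [pathStarForm_add_mul, h2] at h1
  nlinarith

/-- The indicator of a final segment changes only across the edge between `i` and its predecessor.
Testing with it sums the eigenvalue equations over everything beyond that edge. -/
theorem pathStarBilin_Ici {c n i : ℕ} (b : ℕ → ℝ) (hi : 3 ≤ i) (hic : i ≤ c) (hin : i < n) :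
    pathStarBilin c n b (fun j => if i ≤ j then 1 else 0) = b i - b (min (i - 1) c) := by
  have : ∀ j ∈ Finset.Ico 3 n, (b j - b (min (j - 1) c)) *
      ((if i ≤ j then 1 else 0) - (if i ≤ min (j - 1) c then 1 else 0)) =
      if j = i then b j - b (min (j - 1) c) else 0 := by
    intro j _
    rcases lt_trichotomy j i with h | h | h
    · rw [if_neg (by omega), if_neg (by omega), if_neg (by omega)]; ring
    · rw [if_pos (by omega), if_neg (by omega), if_pos h]; ring
    · rw [if_pos (by omega), if_pos (by omega), if_neg (by omega)]; ring
  rw [pathStarBilin, Finset.sum_congr rfl this, Finset.sum_ite_eq',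
    if_pos (show i ∈ Finset.Ico 3 n by simp; omega), if_neg (show ¬ i ≤ 0 by omega),
    if_neg (show ¬ i ≤ 1 by omega), if_neg (show ¬ i ≤ 2 by omega)]
  ring

theorem pathStarBilin_leaf {c n i : ℕ} (b : ℕ → ℝ) (hi : 3 ≤ i) (hic : c < i) (hin : i < n) :
    pathStarBilin c n b (fun j => if j = i then 1 else 0) = b i - b (min (i - 1) c) := by
  have : ∀ j ∈ Finset.Ico 3 n, (b j - b (min (j - 1) c)) *
      ((if j = i then 1 else 0) - (if min (j - 1) c = i then 1 else 0)) =
      if j = i then b j - b (min (j - 1) c) else 0 := by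
    intro j _
    rw [if_neg (show ¬ min (j - 1) c = i by omega)]
    split_ifs <;> ring
  rw [pathStarBilin, Finset.sum_congr rfl this, Finset.sum_ite_eq',
    if_pos (show i ∈ Finset.Ico 3 n by simp; omega), if_neg (show ¬ 0 = i by omega),
    if_neg (show ¬ 1 = i by omega), if_neg (show ¬ 2 = i by omega)]
  ring

theorem pathStarBilin_two {c n : ℕ} (b : ℕ → ℝ) (hc : 2 ≤ c) :
    pathStarBilin c n b (fun j => if 2 ≤ j then 1 else 0) = (b 2 - b 0) + (b 2 - b 1) := by
  have : ∀ j ∈ Finset.Ico 3 n, (b j - b (min (j - 1) c)) *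
      ((if 2 ≤ j then 1 else 0) - (if 2 ≤ min (j - 1) c then 1 else 0)) = 0 := by
    intro j hj
    rw [Finset.mem_Ico] at hj
    rw [if_pos (by omega), if_pos (by omega)]; ring
  rw [pathStarBilin, Finset.sum_congr rfl this]
  simp

/-- This antisymmetric test vector is used to show that the entries of a minimizer at `0` and `1`
agree. -/
theorem pathStarBilin_twins {c n : ℕ} (b : ℕ → ℝ) (hc : 2 ≤ c) :
    pathStarBilin c n b (fun j => if j = 0 then 1 else if j = 1 then -1 else 0) = b 0 - b 1 := by
  have : ∀ j ∈ Finset.Ico 3 n, (b j - b (min (j - 1) c)) *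
      ((if j = 0 then 1 else if j = 1 then -1 else 0) -
        (if min (j - 1) c = 0 then 1 else if min (j - 1) c = 1 then -1 else 0)) = 0 := by
    intro j hj
    rw [Finset.mem_Ico] at hj
    rw [if_neg (by omega), if_neg (by omega), if_neg (by omega), if_neg (by omega)]; ring
  rw [pathStarBilin, Finset.sum_congr rfl this]
  simp

/-- All squares vanish: the entry at each vertex equals that at its predecessor, and the plus sign
at the edge `0 1` makes the common value zero. -/
theorem eq_zero_of_pathStarForm_le_zero {c n : ℕ} {b : ℕ → ℝ} (h0 : 0 ≤ b 0)
    (h1 : 0 ≤ b 1) (hF : pathStarForm c n b ≤ 0) : ∀ j, j < n → b j = 0 := by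
  have hs : ∀ j ∈ Finset.Ico 3 n, 0 ≤ (b j - b (min (j - 1) c)) ^ 2 := fun _ _ => sq_nonneg _
  have hs' := Finset.sum_nonneg hs
  unfold pathStarForm at hF
  have e1 : b 0 + b 1 = 0 := by
    rw [← sq_eq_zero_iff]
    nlinarith [sq_nonneg (b 0 + b 1), sq_nonneg (b 2 - b 0), sq_nonneg (b 2 - b 1)]
  have e2 : b 2 - b 0 = 0 := by
    rw [← sq_eq_zero_iff]
    nlinarith [sq_nonneg (b 0 + b 1), sq_nonneg (b 2 - b 0), sq_nonneg (b 2 - b 1)]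
  have e3 : ∑ j ∈ Finset.Ico 3 n, (b j - b (min (j - 1) c)) ^ 2 = 0 := by
    nlinarith [sq_nonneg (b 0 + b 1), sq_nonneg (b 2 - b 0), sq_nonneg (b 2 - b 1)]
  rw [Finset.sum_eq_zero_iff_of_nonneg hs] at e3
  intro j
  induction j using Nat.strong_induction_on with
  | _ j ih =>
    intro hj
    rcases Nat.lt_or_ge j 3 with h | h
    · interval_cases j <;> linarith
    · have := e3 j (by simp; omega)
      rw [sq_eq_zero_iff, ih (min (j - 1) c) (by omega) (by omega)] at this
      linarith

/-- A nonnegative minimizer increases strictly along the path and towards the leaves. -/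
theorem strictMono_of_minimizer {c n m : ℕ} {lam : ℝ} {b : ℕ → ℝ}
    (hm : 3 ≤ m) (hmn : m ≤ n) (hn : 4 ≤ n) (hc : (m = c + 1 ∧ m < n) ∨ (m = n ∧ n = c + 2))
    (hb0 : ∀ j, j < n → 0 ≤ b j)
    (hmono : ∀ i j, i ≤ j → j < m → b i ≤ b j) (hne : ∃ j, j < n ∧ b j ≠ 0)
    (hmin : ∀ h, lam * ∑ j ∈ Finset.range n, h j ^ 2 ≤ pathStarForm c n h)
    (hb : pathStarForm c n b ≤ lam * ∑ j ∈ Finset.range n, b j ^ 2) :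
    0 < lam ∧ (∀ i, 2 ≤ i → i < n → b (min (i - 1) c) < b i) := by
  have hlam : 0 < lam := by
    by_contra! hlam
    obtain ⟨j, hj, hbj⟩ := hne
    refine hbj (eq_zero_of_pathStarForm_le_zero (hb0 0 (by omega)) (hb0 1 (by omega))
      (hb.trans (mul_nonpos_of_nonpos_of_nonneg hlam ?_)) j hj)
    exact Finset.sum_nonneg fun _ _ => sq_nonneg _
  have heq := pathStarBilin_eq_of_minimizer hmin hb
  have hsum : ∀ i, ∑ j ∈ Finset.range n, b j * (if i ≤ j then 1 else 0) =
      ∑ j ∈ (Finset.range n).filter (fun j => i ≤ j), b j := by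
    intro i; simp [Finset.sum_filter]
  have hnn : ∀ i, ∀ j ∈ (Finset.range n).filter (fun j => i ≤ j), 0 ≤ b j := fun i j hj =>
    hb0 j (by simpa using (Finset.mem_filter.1 hj).1)
  have hpath : ∀ i, 3 ≤ i → i ≤ c →
      b i - b (i - 1) = lam * ∑ j ∈ (Finset.range n).filter (fun j => i ≤ j), b j := by
    intro i h3 hi
    have := heq fun j => if i ≤ j then 1 else 0
    rwa [pathStarBilin_Ici b h3 hi (by omega), hsum, min_eq_left (by omega)] at this
  have htwo : (b 2 - b 0) + (b 2 - b 1) =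
      lam * ∑ j ∈ (Finset.range n).filter (fun j => 2 ≤ j), b j := by
    have := heq fun j => if 2 ≤ j then 1 else 0
    rwa [pathStarBilin_two b (by omega), hsum] at this
  have hleaf : ∀ i, c < i → i < n → b i - b c = lam * b i := by
    intro i hi hin
    have := heq fun j => if j = i then 1 else 0
    rw [pathStarBilin_leaf b (by omega) hi hin, min_eq_right (by omega)] at this
    refine this.trans ?_
    congr 1
    simp [hin]
  have htwin : b 0 - b 1 = lam * (b 0 - b 1) := by
    have := heq fun j => if j = 0 then 1 else if j = 1 then -1 else 0
    rw [pathStarBilin_twins b (by omega)] at this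
    refine this.trans ?_
    congr 1
    rw [← Finset.sum_subset (Finset.range_subset_range.2 (show 2 ≤ n by omega))]
    · simp [Finset.sum_range_succ]; ring
    · intro j _ hj
      rw [Finset.mem_range] at hj
      rw [if_neg (by omega), if_neg (by omega), mul_zero]
  -- If `b c = 0`, monotonicity kills the entries up to `c`; the summed equation for the cut just
  -- before `c` then kills those beyond.
  have hcpos : 0 < b c := by
    by_contra! hbc
    have hlow : ∀ j, j ≤ c → b j = 0 := fun j hj =>
      le_antisymm ((hmono j c hj (by omega)).trans hbc) (hb0 j (by omega))
    have hz : lam * ∑ j ∈ (Finset.range n).filter (fun j => c ≤ j), b j = 0 := by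
      rcases Nat.lt_or_ge 2 c with h | h
      · rw [← hpath c h le_rfl, hlow c le_rfl, hlow (c - 1) (by omega), sub_zero]
      · obtain rfl : c = 2 := by omega
        rw [← htwo, hlow 0 (by omega), hlow 1 (by omega), hlow 2 le_rfl]; norm_num
    have hz' := (mul_eq_zero.1 hz).resolve_left hlam.ne'
    rw [Finset.sum_eq_zero_iff_of_nonneg (hnn c)] at hz'
    obtain ⟨j, hj, hbj⟩ := hne
    rcases le_total j c with h | h
    · exact hbj (hlow j h)
    · exact hbj (hz' j (by simp [hj, h]))
  have hspos : ∀ i, i ≤ c → 0 < ∑ j ∈ (Finset.range n).filter (fun j => i ≤ j), b j :=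
    fun i hi => hcpos.trans_le (Finset.single_le_sum (hnn i) (by simp [hi]; omega))
  -- The leaf equation reads `(1 - lam) * b (n - 1) = b c`, with a positive right-hand side.
  have hlam1 : lam < 1 := by
    have h1 := hleaf (n - 1) (by omega) (by omega)
    by_contra! h2
    nlinarith [hb0 (n - 1) (by omega)]
  have h01 : b 0 = b 1 := by
    have : (1 - lam) * (b 0 - b 1) = 0 := by linarith
    have := (mul_eq_zero.1 this).resolve_left (by linarith)
    linarith
  refine ⟨hlam, fun i hi hin => ?_⟩
  rcases Nat.lt_or_ge 2 i with h3 | h3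
  · rcases le_or_gt i c with hic | hic
    · rw [min_eq_left (by omega)]
      have := mul_pos hlam (hspos i hic)
      linarith [hpath i h3 hic]
    · rw [min_eq_right (by omega)]
      have h4 := hleaf i hic hin
      have h5 : 0 < b i := by
        have := hb0 i hin
        rcases this.lt_or_eq with h | h
        · exact h
        · rw [← h] at h4; linarith
      nlinarith
  · obtain rfl : i = 2 := by omega
    rw [min_eq_left (by omega)]
    have := mul_pos hlam (hspos 2 (by omega))
    norm_num at *
    linarith

/-! ### A connected non-bipartite core around a dominating set. -/

/-- The set `K` of vertices is connected in `G`: every cut of `K` is crossed by an edge. -/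
def CutConnected {W : Type*} (G : SimpleGraph W) (K : Finset W) : Prop :=
  ∀ P : W → Prop, (∃ u ∈ K, P u) → (∃ u ∈ K, ¬ P u) → ∃ u ∈ K, ∃ v ∈ K, P u ∧ ¬ P v ∧ G.Adj u v

/-- No two-colouring of the set `K` of vertices is proper. -/
def NotTwoColorable {W : Type*} (G : SimpleGraph W) (K : Finset W) : Prop :=
  ∀ c : W → Prop, ∃ u ∈ K, ∃ v ∈ K, G.Adj u v ∧ (c u ↔ c v)

section Core

variable {W : Type*} {G : SimpleGraph W}

theorem CutConnected.superset {K K' : Finset W} (hK : CutConnected G K)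
    (hsub : K ⊆ K') (h : ∀ v ∈ K', v ∉ K → ∃ u ∈ K, G.Adj v u) :
    CutConnected G K' := by
  intro P ⟨a, ha, hPa⟩ ⟨b, hb, hPb⟩
  by_cases h1 : ∃ u ∈ K, P u
  · by_cases h2 : ∃ u ∈ K, ¬ P u
    · obtain ⟨u, hu, v, hv, huv⟩ := hK P h1 h2
      exact ⟨u, hsub hu, v, hsub hv, huv⟩
    · push Not at h2
      obtain ⟨u, hu, hbu⟩ := h b hb fun hbK => hPb (h2 b hbK)
      exact ⟨u, hsub hu, b, hb, h2 u hu, hPb, hbu.symm⟩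
  · push Not at h1
    obtain ⟨u, hu, hau⟩ := h a ha fun haK => h1 a haK hPa
    exact ⟨a, ha, u, hsub hu, hPa, h1 u hu, hau⟩

theorem CutConnected.insert [DecidableEq W] {K : Finset W} (hK : CutConnected G K) {u v : W}
    (hu : u ∈ K) (huv : u = v ∨ G.Adj u v) : CutConnected G (insert v K) := by
  rcases huv with rfl | huv
  · rwa [Finset.insert_eq_of_mem hu]
  · refine hK.superset (Finset.subset_insert _ _) fun w hw hwK => ⟨u, hu, ?_⟩
    obtain rfl := (Finset.mem_insert.1 hw).resolve_right hwK
    exact huv.symm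

theorem exists_adj_of_preconnected (hG : G.Preconnected) (P : W → Prop) {a b : W} (ha : P a)
    (hb : ¬ P b) : ∃ u v, P u ∧ ¬ P v ∧ G.Adj u v := by
  obtain ⟨w⟩ := hG a b
  obtain ⟨d, _, h1, h2⟩ := w.exists_boundary_dart {v | P v} ha hb
  exact ⟨d.fst, d.snd, h1, h2, d.adj⟩

theorem exists_adj_of_not_isBipartite (hG : ¬ G.IsBipartite) (c : W → Prop) :
    ∃ u v, G.Adj u v ∧ (c u ↔ c v) := by
  classical
  by_contra! hcon
  refine hG ⟨SimpleGraph.Coloring.mk (fun v => if c v then 0 else 1) ?_⟩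
  intro u v huv
  have := hcon u v huv
  split_ifs <;> simp <;> tauto

/-- Two proper two-colourings of a connected set agree up to a swap of the colours. -/
theorem CutConnected.coloring_unique {K : Finset W} (hK : CutConnected G K) {c c' : W → Prop}
    (hc : ∀ u ∈ K, ∀ v ∈ K, G.Adj u v → ¬ (c u ↔ c v))
    (hc' : ∀ u ∈ K, ∀ v ∈ K, G.Adj u v → ¬ (c' u ↔ c' v)) {u v : W} (hu : u ∈ K) (hv : v ∈ K) :
    (c u ↔ c' u) ↔ (c v ↔ c' v) := by
  by_contra hcon
  obtain ⟨a, ha, b, hb, h1, h2, hab⟩ := hK (fun w => (c w ↔ c' w) ↔ (c u ↔ c' u))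
    ⟨u, hu, Iff.rfl⟩ ⟨v, hv, by tauto⟩
  have h3 := hc a ha b hb hab
  have h4 := hc' a ha b hb hab
  grind

/-- A dominating set `D` of a connected graph lies in a connected set of at most `3 |D| - 2`
vertices. -/
theorem exists_cutConnected_superset [DecidableEq W] (hG : G.Preconnected) {D : Finset W}
    (hD : IsDominatingSet G D) (hne : D.Nonempty) :
    ∃ K, D ⊆ K ∧ CutConnected G K ∧ K.card + 2 ≤ 3 * D.card := by
  have key : ∀ t, 1 ≤ t → t ≤ D.card → ∃ K : Finset W, CutConnected G K ∧ t ≤ (K ∩ D).card ∧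
      K.card + 2 ≤ 3 * (K ∩ D).card := by
    intro t ht
    induction t, ht using Nat.le_induction with
    | base =>
      intro _
      obtain ⟨d, hd⟩ := hne
      refine ⟨{d}, ?_, ?_, ?_⟩
      · intro P ⟨a, ha, hPa⟩ ⟨b, hb, hPb⟩
        rw [Finset.mem_singleton] at ha hb
        subst ha; subst hb; exact absurd hPa hPb
      · rw [Finset.singleton_inter_of_mem hd]; simp
      · rw [Finset.singleton_inter_of_mem hd]; simp
    | succ t ht ih =>
      intro hle
      obtain ⟨K, hK, hKt, hKc⟩ := ih (by omega)
      rcases Nat.lt_or_ge t (K ∩ D).card with hlt | hge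
      · exact ⟨K, hK, hlt, hKc⟩
      have hKne : K.Nonempty := by
        rw [Finset.nonempty_iff_ne_empty]; rintro rfl; simp at hKt; omega
      obtain ⟨d0, hd0, hd0K⟩ : ∃ d ∈ D, d ∉ K := by
        by_contra! hcon
        rw [Finset.inter_eq_right.2 hcon] at hge
        omega
      -- If `d0` is not adjacent to `K`, take an edge `a b` leaving the closed neighbourhood of `K`.
      -- A vertex `d` of `D` equal or adjacent to `b` cannot lie in `K`, so at most three insertions
      -- gain a new vertex of `D`; coincidences among `a`, `b`, `d` are harmless.
      have hext : ∃ a b d, d ∈ D ∧ d ∉ K ∧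
          CutConnected G (insert d (insert b (insert a K))) := by
        by_cases h1 : ∃ u ∈ K, G.Adj u d0
        · obtain ⟨u, hu, hud⟩ := h1
          refine ⟨u, u, d0, hd0, hd0K, ?_⟩
          rw [Finset.insert_eq_of_mem hu, Finset.insert_eq_of_mem hu]
          exact hK.insert hu (Or.inr hud)
        · obtain ⟨k, hk⟩ := hKne
          obtain ⟨a, b, ha, hb, hab⟩ := exists_adj_of_preconnected hG
            (fun v => v ∈ K ∨ ∃ u ∈ K, G.Adj u v) (Or.inl hk) (b := d0)
            (by rintro (h | h); exacts [hd0K h, h1 h])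
          push Not at hb
          have ha' : ∃ u ∈ K, u = a ∨ G.Adj u a := by
            rcases ha with ha | ⟨u, hu, hua⟩
            · exact ⟨a, ha, Or.inl rfl⟩
            · exact ⟨u, hu, Or.inr hua⟩
          obtain ⟨d, hd, hbd⟩ : ∃ d ∈ D, b = d ∨ G.Adj b d := by
            by_cases hbD : b ∈ D
            · exact ⟨b, hbD, Or.inl rfl⟩
            · obtain ⟨d, hd, h⟩ := hD b hbD
              exact ⟨d, hd, Or.inr h⟩
          refine ⟨a, b, d, hd, ?_, ?_⟩
          · intro hdK
            rcases hbd with rfl | hbd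
            · exact hb.1 hdK
            · exact hb.2 d hdK hbd.symm
          · obtain ⟨u, hu, hua⟩ := ha'
            exact ((hK.insert hu hua).insert (Finset.mem_insert_self _ _) (Or.inr hab)).insert
              (Finset.mem_insert_self _ _) hbd
      obtain ⟨a, b, d, hd, hdK, hconn⟩ := hext
      have h1 : (K ∩ D).card + 1 ≤ (insert d (insert b (insert a K)) ∩ D).card := by
        rw [← Finset.card_insert_of_notMem (a := d) (s := K ∩ D) (by simp [hdK])]
        refine Finset.card_le_card fun w hw => ?_
        simp only [Finset.mem_insert, Finset.mem_inter] at hw ⊢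
        rcases hw with rfl | ⟨h, h'⟩
        · exact ⟨Or.inl rfl, hd⟩
        · exact ⟨by tauto, h'⟩
      have h2 := Finset.card_insert_le d (insert b (insert a K))
      have h3 := Finset.card_insert_le b (insert a K)
      have h4 := Finset.card_insert_le a K
      exact ⟨_, hconn, by omega, by omega⟩
  obtain ⟨K, hK, h1, h2⟩ := key D.card hne.card_pos le_rfl
  have hKD : K ∩ D = D := Finset.eq_of_subset_of_card_le Finset.inter_subset_right h1
  rw [hKD] at h2
  exact ⟨K, Finset.inter_eq_right.1 hKD, hK, h2⟩

/-- A connected non-bipartite graph of order `n` with a dominating set `D` has a connected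
non-bipartite dominating set of exactly `min (3 |D|) n` vertices. -/
theorem exists_core [Fintype W] (hG : G.Preconnected) (hodd : ¬ G.IsBipartite) {D : Finset W}
    (hD : IsDominatingSet G D) (hne : D.Nonempty) :
    ∃ K : Finset W, K.card = min (3 * D.card) (Fintype.card W) ∧ CutConnected G K ∧
      NotTwoColorable G K ∧ ∀ v, v ∉ K → ∃ u ∈ K, G.Adj v u := by
  classical
  obtain ⟨K, hDK, hK, hcard⟩ := exists_cutConnected_superset hG hD hne
  have hKne : K.Nonempty := hne.mono hDK
  have hdom : ∀ v, v ∉ K → ∃ u ∈ K, G.Adj v u := fun v hv => by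
    obtain ⟨u, hu, h⟩ := hD v fun h => hv (hDK h)
    exact ⟨u, hDK hu, h⟩
  have hodd' : ∃ a b, NotTwoColorable G (insert a (insert b K)) := by
    by_cases hcol : NotTwoColorable G K
    · obtain ⟨k, hk⟩ := hKne
      exact ⟨k, k, by rwa [Finset.insert_eq_of_mem hk, Finset.insert_eq_of_mem hk]⟩
    unfold NotTwoColorable at hcol
    push Not at hcol
    obtain ⟨c, hc⟩ := hcol
    choose! f hfK hf using hdom
    -- Extend the colouring of `K` by giving each outside vertex the colour opposite to that of its
    -- neighbour `f v`. A monochromatic edge `a b` remains. A proper colouring of `K` with `a` and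
    -- `b` would agree with this one up to a swap on `K`, hence at `a` and `b` too.
    obtain ⟨a, b, hab, hcab⟩ := exists_adj_of_not_isBipartite hodd
      fun v => if v ∈ K then c v else ¬ c (f v)
    refine ⟨a, b, fun c' => ?_⟩
    by_contra! hc'
    have hsub : ∀ v ∈ K, v ∈ insert a (insert b K) := fun v hv => by simp [hv]
    have huniq : ∀ u ∈ K, ∀ v ∈ K, ((c u ↔ c' u) ↔ (c v ↔ c' v)) := fun u hu v hv =>
      hK.coloring_unique (fun u hu v hv h => by have := hc u hu v hv h; tauto)
        (fun u hu v hv h => by have := hc' u (hsub u hu) v (hsub v hv) h; tauto) hu hv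
    have hne' : ∀ v ∈ insert a (insert b K), v ∉ K → ¬ (c' v ↔ c' (f v)) := fun v hv hvK => by
      have := hc' v hv (f v) (hsub _ (hfK v hvK)) (hf v hvK); tauto
    have h1 := hc' a (by simp) b (by simp) hab
    have h2 := hne' a (by simp)
    have h3 := hne' b (by simp)
    by_cases ha : a ∈ K <;> by_cases hb : b ∈ K <;> simp only [ha, hb, if_true, if_false] at hcab
    · have := huniq a ha b hb; grind
    · have := huniq a ha (f b) (hfK b hb); grind
    · have := huniq (f a) (hfK a ha) b hb; grind
    · have := huniq (f a) (hfK a ha) (f b) (hfK b hb); grind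
  obtain ⟨a, b, hab⟩ := hodd'
  have h1 := Finset.card_insert_le a (insert b K)
  have h2 := Finset.card_insert_le b K
  -- The count is `(3 |D| - 2) + 2`.
  have h3 : (insert a (insert b K)).card ≤ min (3 * D.card) (Fintype.card W) :=
    le_min (by omega) (Finset.card_le_univ _)
  obtain ⟨K', hsub, hK'⟩ := Finset.exists_superset_card_eq h3 (min_le_right _ _)
  have hKK' : K ⊆ K' := fun v hv => hsub (by simp [hv])
  refine ⟨K', hK', hK.superset hKK' fun v _ hv => hdom v hv, fun c => ?_, fun v hv => ?_⟩
  · obtain ⟨u, hu, v, hv, h⟩ := hab c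
    exact ⟨u, hsub hu, v, hsub hv, h⟩
  · obtain ⟨u, hu, h⟩ := hdom v fun h => hv (hKK' h)
    exact ⟨u, hKK' hu, h⟩

theorem exists_sorted_enum [Fintype W] {n m : ℕ} (hW : Fintype.card W = n) {K : Finset W}
    (hK : K.card = m) (x : W → ℝ) :
    ∃ e : Fin n ≃ W, (∀ i, i.val < m ↔ e i ∈ K) ∧
      ∀ i j, i ≤ j → j.val < m → |x (e i)| ≤ |x (e j)| := by
  classical
  have hcompl : Fintype.card {v // ¬ v ∈ K} = n - m := by
    rw [Fintype.card_subtype_compl, hW, Fintype.card_coe, hK]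
  have hmn : m ≤ n := by rw [← hK, ← hW]; exact Finset.card_le_univ _
  obtain ⟨r, rfl⟩ : ∃ r, n = m + r := ⟨n - m, by omega⟩
  let e0 : Fin m ≃ {v // v ∈ K} := (K.equivFinOfCardEq hK).symm
  let e1 : Fin m ≃ {v // v ∈ K} := (Tuple.sort fun i => |x (e0 i)|).trans e0
  let e2 : Fin r ≃ {v // ¬ v ∈ K} := (Fintype.equivFinOfCardEq (by rw [hcompl]; omega)).symm
  let e : Fin (m + r) ≃ W :=
    finSumFinEquiv.symm.trans ((Equiv.sumCongr e1 e2).trans (Equiv.sumCompl (· ∈ K)))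
  have he1 : ∀ i : Fin m, e (Fin.castAdd r i) = e1 i := fun i => by simp [e]
  have he2 : ∀ i : Fin r, e (Fin.natAdd m i) = e2 i := fun i => by simp [e]
  refine ⟨e, fun i => ?_, fun i j hij hj => ?_⟩
  · refine Fin.addCases (fun i => ?_) (fun i => ?_) i
    · simp [he1]
    · simp [he2, (e2 i).2]
  · have hi : i.val < m := lt_of_le_of_lt hij hj
    have := Tuple.monotone_sort (fun i => |x (e0 i)|) (show (⟨i, hi⟩ : Fin m) ≤ ⟨j, hj⟩ from hij)
    have h1 := he1 ⟨i, hi⟩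
    have h2 := he1 ⟨j, hj⟩
    rw [show Fin.castAdd r ⟨i, hi⟩ = i from rfl] at h1
    rw [show Fin.castAdd r ⟨j, hj⟩ = j from rfl] at h2
    rw [h1, h2]
    exact this

end Core

/-! ### Rayleigh quotients of the signless Laplacian. -/

/-- The edges of `G` in terms of an enumeration of the vertices. -/
def enumRel {W : Type*} {n : ℕ} (G : SimpleGraph W) (e : Fin n ≃ W) (p q : ℕ) : Prop :=
  ∃ (hp : p < n) (hq : q < n), G.Adj (e ⟨p, hp⟩) (e ⟨q, hq⟩)

/-- A vector in terms of an enumeration of the coordinates. -/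
noncomputable def enumVec {W : Type*} {n : ℕ} (e : Fin n ≃ W) (x : W → ℝ) (p : ℕ) : ℝ :=
  if h : p < n then x (e ⟨p, h⟩) else 0

theorem enumVec_val {W : Type*} {n : ℕ} (e : Fin n ≃ W) (x : W → ℝ) (i : Fin n) :
    enumVec e x i.val = x (e i) := by simp [enumVec]

theorem enumRel_val {W : Type*} {n : ℕ} {G : SimpleGraph W} {e : Fin n ≃ W} {i j : Fin n} :
    enumRel G e i.val j.val ↔ G.Adj (e i) (e j) := by simp [enumRel]

section LeastEigenvalue

variable {W : Type*} [Fintype W]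

theorem isHermitian_signlessLaplacian (G : SimpleGraph W) : (signlessLaplacian G).IsHermitian := by
  classical
  unfold signlessLaplacian
  rw [Matrix.IsHermitian, Matrix.conjTranspose_eq_transpose_of_trivial]
  convert ((G.isSymm_degMatrix (R := ℝ)).add (G.isSymm_adjMatrix (α := ℝ))).eq

open Classical in
theorem signlessLaplacian_mulVec (G : SimpleGraph W) (x : W → ℝ) (v : W) :
    (signlessLaplacian G).mulVec x v = ∑ u, if G.Adj v u then x v + x u else 0 := by
  have h : signlessLaplacian G = G.degMatrix ℝ + G.adjMatrix ℝ := by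
    unfold signlessLaplacian; congr!
  rw [h, Matrix.add_mulVec, Pi.add_apply, SimpleGraph.adjMatrix_mulVec_apply,
    SimpleGraph.degMatrix, Matrix.mulVec_diagonal, ← Finset.sum_filter, Finset.sum_add_distrib,
    ← SimpleGraph.neighborFinset_eq_filter]
  simp

theorem signlessLaplacian_mulVec_neighborFinset (G : SimpleGraph W) (x : W → ℝ) (v : W)
    [Fintype (G.neighborSet v)] :
    (signlessLaplacian G).mulVec x v = ∑ u ∈ G.neighborFinset v, (x v + x u) := by
  classical
  rw [signlessLaplacian_mulVec, ← Finset.sum_filter]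
  refine Finset.sum_congr ?_ fun _ _ => rfl
  ext u; simp

open Classical in
theorem dotProduct_signlessLaplacian (G : SimpleGraph W) (x : W → ℝ) :
    2 * (x ⬝ᵥ (signlessLaplacian G).mulVec x) =
      ∑ u, ∑ v, if G.Adj u v then (x u + x v) ^ 2 else 0 := by
  have h1 : x ⬝ᵥ (signlessLaplacian G).mulVec x =
      ∑ u, ∑ v, if G.Adj u v then x u * (x u + x v) else 0 := by
    refine Finset.sum_congr rfl fun u _ => ?_
    rw [signlessLaplacian_mulVec, Finset.mul_sum]
    exact Finset.sum_congr rfl fun v _ => by split_ifs <;> simp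
  have h2 : x ⬝ᵥ (signlessLaplacian G).mulVec x =
      ∑ u, ∑ v, if G.Adj u v then x v * (x u + x v) else 0 := by
    rw [h1, Finset.sum_comm]
    refine Finset.sum_congr rfl fun u _ => Finset.sum_congr rfl fun v _ => ?_
    rw [G.adj_comm, add_comm]
  rw [two_mul]
  nth_rw 1 [h1]
  rw [h2, ← Finset.sum_add_distrib]
  refine Finset.sum_congr rfl fun u _ => ?_
  rw [← Finset.sum_add_distrib]
  refine Finset.sum_congr rfl fun v _ => ?_
  split_ifs <;> ring

theorem exists_eigenvector_qMin [Nonempty W] (G : SimpleGraph W) :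
    ∃ x : W → ℝ, x ≠ 0 ∧ (signlessLaplacian G).mulVec x = qMin G • x := by
  classical
  obtain ⟨x, hx⟩ := (isLeast_qMin G).1.exists_hasEigenvector
  refine ⟨x, hx.2, ?_⟩
  have := hx.apply_eq_smul
  rw [Matrix.toLin'_apply] at this
  convert this

/-- Each eigenvalue of `Q - qMin • 1` becomes an eigenvalue of `Q` when `qMin` is added, so it is
nonnegative and the shifted matrix is positive semidefinite. -/
theorem qMin_mul_le [Nonempty W] (G : SimpleGraph W) (x : W → ℝ) :
    qMin G * ∑ v, x v ^ 2 ≤ x ⬝ᵥ (signlessLaplacian G).mulVec x := by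
  classical
  have hH : (signlessLaplacian G - qMin G • (1 : Matrix W W ℝ)).IsHermitian :=
    (isHermitian_signlessLaplacian G).sub (by
      rw [Matrix.IsHermitian, Matrix.conjTranspose_smul, Matrix.conjTranspose_one]; simp)
  have hpsd : (signlessLaplacian G - qMin G • (1 : Matrix W W ℝ)).PosSemidef := by
    rw [hH.posSemidef_iff_eigenvalues_nonneg]
    intro i
    have h1 := hH.mulVec_eigenvectorBasis i
    rw [Matrix.sub_mulVec, Matrix.smul_mulVec, Matrix.one_mulVec, sub_eq_iff_eq_add,
      ← add_smul] at h1
    have h2 : Module.End.HasEigenvalue (Matrix.toLin' (signlessLaplacian G))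
        (hH.eigenvalues i + qMin G) := by
      refine Module.End.hasEigenvalue_of_hasEigenvector
        (x := (hH.eigenvectorBasis i : W → ℝ)) ⟨?_, ?_⟩
      · rw [Module.End.mem_eigenspace_iff, Matrix.toLin'_apply]
        exact h1
      · intro h0
        apply hH.eigenvectorBasis.orthonormal.ne_zero i
        ext j; exact congrFun h0 j
    have h3 := (isLeast_qMin G).2 (show _ ∈ {μ : ℝ | _} by convert h2)
    simp only [Pi.zero_apply]
    linarith
  have h := hpsd.dotProduct_mulVec_nonneg x
  rw [Matrix.sub_mulVec, Matrix.smul_mulVec, Matrix.one_mulVec, dotProduct_sub, dotProduct_smul,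
    star_trivial] at h
  have h' : x ⬝ᵥ x = ∑ v, x v ^ 2 := Finset.sum_congr rfl fun v _ => (sq (x v)).symm
  rw [h', smul_eq_mul] at h
  linarith

theorem exists_qMin_form [Nonempty W] (G : SimpleGraph W) :
    ∃ x : W → ℝ, x ≠ 0 ∧ x ⬝ᵥ (signlessLaplacian G).mulVec x = qMin G * ∑ v, x v ^ 2 := by
  obtain ⟨x, hx, h⟩ := exists_eigenvector_qMin G
  refine ⟨x, hx, ?_⟩
  rw [h, dotProduct_smul, smul_eq_mul]
  congr 1
  exact Finset.sum_congr rfl fun v _ => (sq (x v)).symm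

theorem dotProduct_signlessLaplacian_nonneg (G : SimpleGraph W) (x : W → ℝ) :
    0 ≤ x ⬝ᵥ (signlessLaplacian G).mulVec x := by
  classical
  have h := dotProduct_signlessLaplacian G x
  have : 0 ≤ ∑ u, ∑ v, if G.Adj u v then (x u + x v) ^ 2 else 0 :=
    Finset.sum_nonneg fun u _ => Finset.sum_nonneg fun v _ => by split_ifs <;> positivity
  linarith

theorem sum_sq_pos {x : W → ℝ} (hx : x ≠ 0) : 0 < ∑ v, x v ^ 2 := by
  obtain ⟨v, hv⟩ := Function.ne_iff.1 hx
  exact Finset.sum_pos' (fun _ _ => sq_nonneg _) ⟨v, Finset.mem_univ _, sq_pos_of_ne_zero hv⟩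

theorem qMin_nonneg [Nonempty W] (G : SimpleGraph W) : 0 ≤ qMin G := by
  obtain ⟨x, hx, h⟩ := exists_qMin_form G
  have h1 := dotProduct_signlessLaplacian_nonneg G x
  have h2 := sum_sq_pos hx
  by_contra! h3
  nlinarith

theorem sum_range_enumVec {n : ℕ} (e : Fin n ≃ W) (x : W → ℝ) (φ : ℝ → ℝ) :
    ∑ j ∈ Finset.range n, φ (enumVec e x j) = ∑ v, φ (x v) := by
  rw [← Fin.sum_univ_eq_sum_range (fun j => φ (enumVec e x j)), ← e.sum_comp]
  simp only [enumVec_val]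

theorem sum_range_symm (g : ℕ → ℕ → ℝ) (hs : ∀ i j, g i j = g j i) (h0 : ∀ i, g i i = 0) (n : ℕ) :
    ∑ i ∈ Finset.range n, ∑ j ∈ Finset.range n, g i j =
      2 * ∑ j ∈ Finset.range n, ∑ i ∈ Finset.range j, g i j := by
  induction n with
  | zero => simp
  | succ n ih =>
    rw [Finset.sum_range_succ, Finset.sum_range_succ _ n, Finset.sum_range_succ _ n]
    simp only [Finset.sum_range_succ, Finset.sum_add_distrib, h0, ih]
    rw [Finset.sum_congr rfl fun i _ => hs n i]
    ring

open Classical in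
theorem signlessForm_eq_sum_range (A : ℕ → ℕ → Prop) (n : ℕ) (x : ℕ → ℝ) :
    signlessForm A n x =
      ∑ q ∈ Finset.range n, ∑ p ∈ Finset.range q, if A p q then (x p + x q) ^ 2 else 0 := by
  rw [signlessForm, Finset.sum_sigma', ← Finset.sum_filter]
  refine Finset.sum_bij' (fun e _ => ⟨e.2, e.1⟩) (fun s _ => (s.2, s.1)) ?_ ?_ ?_ ?_ ?_
  · intro e he
    obtain ⟨h1, h2, h3⟩ := mem_edgePairs.1 he
    simp [h1, h2, h3]
  · rintro ⟨q, p⟩ h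
    simp only [Finset.mem_filter, Finset.mem_sigma, Finset.mem_range] at h
    exact mem_edgePairs.2 ⟨h.1.2, h.1.1, h.2⟩
  · simp
  · simp
  · simp

theorem dotProduct_eq_signlessForm {n : ℕ} (G : SimpleGraph W) (e : Fin n ≃ W) (x : W → ℝ) :
    x ⬝ᵥ (signlessLaplacian G).mulVec x = signlessForm (enumRel G e) n (enumVec e x) := by
  classical
  have h1 := dotProduct_signlessLaplacian G x
  have h2 := sum_range_symm
    (fun i j => if enumRel G e i j then (enumVec e x i + enumVec e x j) ^ 2 else 0)
    (fun i j => by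
      have : enumRel G e i j ↔ enumRel G e j i :=
        ⟨fun ⟨a, b, h⟩ => ⟨b, a, h.symm⟩, fun ⟨a, b, h⟩ => ⟨b, a, h.symm⟩⟩
      simp only [this, add_comm])
    (fun i => if_neg fun ⟨_, _, h⟩ => G.loopless.irrefl _ h) n
  rw [← signlessForm_eq_sum_range] at h2
  have h3 : ∑ u, ∑ v, (if G.Adj u v then (x u + x v) ^ 2 else 0) =
      ∑ i ∈ Finset.range n, ∑ j ∈ Finset.range n,
        if enumRel G e i j then (enumVec e x i + enumVec e x j) ^ 2 else 0 := by
    rw [← Fin.sum_univ_eq_sum_range (fun i => ∑ j ∈ Finset.range n,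
        if enumRel G e i j then (enumVec e x i + enumVec e x j) ^ 2 else 0), ← e.sum_comp]
    refine Finset.sum_congr rfl fun i _ => ?_
    rw [← Fin.sum_univ_eq_sum_range (fun j =>
        if enumRel G e i j then (enumVec e x i + enumVec e x j) ^ 2 else 0), ← e.sum_comp]
    simp only [enumRel_val, enumVec_val]
  linarith

theorem qMin_le_of_iso {W' : Type*} [Fintype W'] [Nonempty W] [Nonempty W'] {G : SimpleGraph W}
    {G' : SimpleGraph W'} (φ : G ≃g G') : qMin G' ≤ qMin G := by
  obtain ⟨x, hx, h⟩ := exists_qMin_form G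
  have e : Fin (Fintype.card W) ≃ W := (Fintype.equivFin W).symm
  have h1 := qMin_mul_le G' (x ∘ φ.symm)
  have h2 : enumRel G' (e.trans φ.toEquiv) = enumRel G e := by
    ext p q; exact exists_congr fun _ => exists_congr fun _ => φ.map_adj_iff
  have h3 : enumVec (e.trans φ.toEquiv) (x ∘ φ.symm) = enumVec e x := by
    ext p; simp [enumVec]
  rw [dotProduct_eq_signlessForm G' (e.trans φ.toEquiv), h2, h3, ← dotProduct_eq_signlessForm, h]
    at h1
  have h4 : ∑ v, (x ∘ φ.symm) v ^ 2 = ∑ v, x v ^ 2 :=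
    (φ.symm.toEquiv.sum_comp fun v => x v ^ 2)
  rw [h4] at h1
  exact le_of_mul_le_mul_right h1 (sum_sq_pos hx)

theorem qMin_congr {W' : Type*} [Fintype W'] [Nonempty W] [Nonempty W'] {G : SimpleGraph W}
    {G' : SimpleGraph W'} (φ : G ≃g G') : qMin G = qMin G' :=
  le_antisymm (qMin_le_of_iso φ.symm) (qMin_le_of_iso φ)

end LeastEigenvalue

/-! ### The triangle with a path and a star: domination number, form and rigidity. -/

theorem dominationNumber_le {W : Type*} [Fintype W] {G : SimpleGraph W} {S : Finset W}
    (hS : IsDominatingSet G S) : dominationNumber G ≤ S.card :=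
  Nat.sInf_le ⟨S, hS, rfl⟩

theorem exists_dominatingSet_card_eq {W : Type*} [Fintype W] (G : SimpleGraph W) :
    ∃ S : Finset W, IsDominatingSet G S ∧ S.card = dominationNumber G :=
  Nat.sInf_mem (s := {m : ℕ | ∃ S : Finset W, IsDominatingSet G S ∧ S.card = m})
    ⟨_, Finset.univ, fun v hv => absurd (Finset.mem_univ v) hv, rfl⟩

/-- Apart from the triangle, the graph is a tree in which `min (j - 1) c` is the parent of `j`, with
`c = n - k - 1` the star centre. This description matches `pathStarForm`. -/
theorem graphU_three_adj {n k : ℕ} (hkn : 3 + k ≤ n) {i j : Fin n} (hij : i < j) :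
    (graphU n k 3).Adj i j ↔ j.val ≤ 2 ∨ i.val = min (j.val - 1) (n - k - 1) := by
  have h1 : i.val < j.val := hij
  have h2 := j.isLt
  simp only [graphU, SimpleGraph.fromRel_adj, ne_eq, Fin.ext_iff]
  omega

theorem graphU_three_connected {n k : ℕ} (hk : 1 ≤ k) (hkn : 3 + k ≤ n) :
    (graphU n k 3).Connected := by
  have hreach : ∀ j (hj : j < n), (graphU n k 3).Reachable ⟨j, hj⟩ ⟨0, by omega⟩ := by
    intro j
    induction j using Nat.strong_induction_on with
    | _ j ih =>
      intro hj
      rcases Nat.eq_zero_or_pos j with rfl | hpos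
      · exact SimpleGraph.Reachable.refl _
      · refine SimpleGraph.Reachable.trans (SimpleGraph.Adj.reachable ?_)
          (ih (min (j - 1) (n - k - 1)) (by omega) (by omega))
        exact ((graphU_three_adj (i := ⟨min (j - 1) (n - k - 1), by omega⟩) (j := ⟨j, hj⟩) hkn
          (Fin.mk_lt_mk.2 (by omega))).2 (Or.inr rfl)).symm
  have : Nonempty (Fin n) := ⟨⟨0, by omega⟩⟩
  exact ⟨fun u v => (hreach u u.2).trans (hreach v v.2).symm⟩

theorem graphU_three_not_isBipartite {n k : ℕ} (hkn : 3 + k ≤ n) :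
    ¬ (graphU n k 3).IsBipartite := by
  rintro ⟨C⟩
  have h01 := C.valid ((graphU_three_adj hkn (i := ⟨0, by omega⟩) (j := ⟨1, by omega⟩)
    (by simp)).2 (by simp))
  have h02 := C.valid ((graphU_three_adj hkn (i := ⟨0, by omega⟩) (j := ⟨2, by omega⟩)
    (by simp)).2 (by simp))
  have h12 := C.valid ((graphU_three_adj hkn (i := ⟨1, by omega⟩) (j := ⟨2, by omega⟩)
    (by simp)).2 (by simp))
  omega

theorem dominationNumber_graphU_three {n k : ℕ} (hk : 1 ≤ k) (hkn : 3 + k ≤ n) :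
    dominationNumber (graphU n k 3) = (n - k - 1) / 3 + 1 := by
  classical
  obtain ⟨c, hc⟩ : ∃ c, c = n - k - 1 := ⟨_, rfl⟩
  have hadj : ∀ i j : Fin n, (graphU n k 3).Adj i j ↔
      (i.val < j.val ∧ (j.val ≤ 2 ∨ i.val = min (j.val - 1) c)) ∨
      (j.val < i.val ∧ (i.val ≤ 2 ∨ j.val = min (i.val - 1) c)) := by
    intro i j
    rcases lt_trichotomy i j with h | h | h
    · rw [graphU_three_adj hkn h]; have : i.val < j.val := h; omega
    · subst h; simp
    · rw [SimpleGraph.adj_comm, graphU_three_adj hkn h]; have : j.val < i.val := h; omega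
  rw [← hc]
  apply le_antisymm
  -- Every third vertex, counted backwards from the star centre.
  · let S : Finset (Fin n) :=
      (Finset.range (c / 3 + 1)).image fun j => (⟨c - 3 * j, by omega⟩ : Fin n)
    have hmem : ∀ v : Fin n, v.val ≤ c → (c - v.val) % 3 = 0 → v ∈ S := fun v hv h =>
      Finset.mem_image.2 ⟨(c - v.val) / 3, Finset.mem_range.2 (by omega), Fin.ext (by simp; omega)⟩
    refine (dominationNumber_le (S := S) fun v hv => ?_).trans
      (Finset.card_image_le.trans (Finset.card_range _).le)
    have hv2 := v.isLt
    rcases Nat.lt_or_ge c v.val with h | h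
    · exact ⟨⟨c, by omega⟩, hmem _ le_rfl (by simp), (hadj _ _).2 (by simp only; omega)⟩
    · have h0 : (c - v.val) % 3 ≠ 0 := fun h0 => hv (hmem v h h0)
      by_cases h1 : (c - v.val) % 3 = 1
      · exact ⟨⟨v.val + 1, by omega⟩, hmem _ (by simp only; omega) (by simp only; omega),
          (hadj _ _).2 (by simp only; omega)⟩
      -- For `v = 0` one has `c ≡ 2` modulo `3`, so `2` is chosen and dominates `0` through the
      -- triangle.
      · rcases Nat.eq_zero_or_pos v.val with hz | hz
        · exact ⟨⟨2, by omega⟩, hmem _ (by simp only; omega) (by simp only; omega),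
            (hadj _ _).2 (by simp only; omega)⟩
        · exact ⟨⟨v.val - 1, by omega⟩, hmem _ (by simp only; omega) (by simp only; omega),
            (hadj _ _).2 (by simp only; omega)⟩
  · obtain ⟨S, hS, hcard⟩ := exists_dominatingSet_card_eq (graphU n k 3)
    rw [← hcard]
    -- The blocks contain the disjoint closed neighbourhoods of `c - 2 - 3 * j` and of the leaf `n -
    -- 1`, so each needs its own dominating vertex. The minimum with `c / 3 - 1` matters when the
    -- last of these vertices is `2`, which is also adjacent to `0`.
    let β : Fin n → ℕ := fun v =>
      if c ≤ v.val then c / 3 else min ((c - 1 - v.val) / 3) (c / 3 - 1)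
    have hdom : ∀ w : Fin n, ∃ v ∈ S, v = w ∨ (graphU n k 3).Adj w v := by
      intro w
      by_cases hw : w ∈ S
      · exact ⟨w, hw, Or.inl rfl⟩
      · obtain ⟨v, hv, h⟩ := hS w hw
        exact ⟨v, hv, Or.inr h⟩
    have hsub : Finset.range (c / 3 + 1) ⊆ S.image β := by
      intro j hj
      rw [Finset.mem_range] at hj
      rw [Finset.mem_image]
      rcases Nat.lt_or_ge j (c / 3) with h | h
      · obtain ⟨v, hv, hvw⟩ := hdom ⟨c - 2 - 3 * j, by omega⟩
        rw [hadj, Fin.ext_iff] at hvw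
        refine ⟨v, hv, ?_⟩
        simp only [β]
        simp only at hvw
        split_ifs <;> omega
      · obtain ⟨v, hv, hvw⟩ := hdom ⟨n - 1, by omega⟩
        rw [hadj, Fin.ext_iff] at hvw
        have hv2 := v.isLt
        refine ⟨v, hv, ?_⟩
        simp only [β]
        simp only at hvw
        split_ifs <;> omega
    calc c / 3 + 1 = (Finset.range (c / 3 + 1)).card := (Finset.card_range _).symm
      _ ≤ (S.image β).card := Finset.card_le_card hsub
      _ ≤ S.card := Finset.card_image_le

/-- The signs which turn the signless Laplacian form of `graphU n k 3` into `pathStarForm`. -/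
def pathStarSign (c j : ℕ) : ℝ := if j = 0 then 1 else (-1) ^ (min j (c + 1) + 1)

theorem pathStarSign_sq (c j : ℕ) : pathStarSign c j ^ 2 = 1 := by
  unfold pathStarSign
  split_ifs
  · norm_num
  · rw [← pow_mul, mul_comm, pow_mul]; norm_num

theorem pathStarSign_parent {c j : ℕ} (hc : 2 ≤ c) (hj : 3 ≤ j) :
    pathStarSign c (min (j - 1) c) = - pathStarSign c j := by
  rw [pathStarSign, pathStarSign, if_neg (by omega), if_neg (by omega),
    show min j (c + 1) = min (min (j - 1) c) (c + 1) + 1 by omega]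
  ring

/-- The signs alternate along every edge except `0 1`, so the signed vector has signless Laplacian
form exactly `pathStarForm`. -/
theorem qMin_graphU_mul_le {n k : ℕ} (hk : 1 ≤ k) (hkn : 3 + k ≤ n) (b : ℕ → ℝ) :
    qMin (graphU n k 3) * ∑ j ∈ Finset.range n, b j ^ 2 ≤ pathStarForm (n - k - 1) n b := by
  classical
  have : Nonempty (Fin n) := ⟨⟨0, by omega⟩⟩
  obtain ⟨c, hc⟩ : ∃ c, c = n - k - 1 := ⟨_, rfl⟩
  let x : Fin n → ℝ := fun i => pathStarSign c i.val * b i.val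
  have h1 := qMin_mul_le (graphU n k 3) x
  have hx : ∀ j, j < n → enumVec (Equiv.refl _) x j = pathStarSign c j * b j := fun j hj => by
    simp [enumVec, hj, x]
  have h2 : ∑ v, x v ^ 2 = ∑ j ∈ Finset.range n, b j ^ 2 := by
    rw [← Fin.sum_univ_eq_sum_range (fun j => b j ^ 2)]
    refine Finset.sum_congr rfl fun i _ => ?_
    simp only [x]
    rw [mul_pow, pathStarSign_sq, one_mul]
  have hrel : ∀ p q, p < q → q < n → (enumRel (graphU n k 3) (Equiv.refl _) p q ↔
      q ≤ 2 ∨ p = min (q - 1) c) := by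
    intro p q hpq hq
    rw [hc, ← graphU_three_adj (i := ⟨p, by omega⟩) (j := ⟨q, hq⟩) hkn (Fin.mk_lt_mk.2 hpq)]
    exact ⟨fun ⟨_, _, h⟩ => h, fun h => ⟨by omega, hq, h⟩⟩
  rw [h2, dotProduct_eq_signlessForm _ (Equiv.refl _), signlessForm_eq_sum_range] at h1
  have h3 : ∀ q ∈ Finset.Ico 3 n, (∑ p ∈ Finset.range q,
      if enumRel (graphU n k 3) (Equiv.refl _) p q then
        (enumVec (Equiv.refl _) x p + enumVec (Equiv.refl _) x q) ^ 2 else 0) =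
      (b q - b (min (q - 1) c)) ^ 2 := by
    intro q hq
    rw [Finset.mem_Ico] at hq
    rw [Finset.sum_eq_single_of_mem (min (q - 1) c) (Finset.mem_range.2 (by omega)),
      if_pos ((hrel _ _ (by omega) hq.2).2 (Or.inr rfl)), hx _ (by omega), hx _ hq.2,
      pathStarSign_parent (by omega) hq.1]
    · linear_combination (b q - b (min (q - 1) c)) ^ 2 * pathStarSign_sq c q
    · intro p hp hne
      rw [Finset.mem_range] at hp
      rw [if_neg (by rw [hrel p q hp hq.2]; omega)]
  refine h1.trans (le_of_eq ?_)
  rw [← Finset.sum_range_add_sum_Ico _ (show 3 ≤ n by omega), Finset.sum_congr rfl h3, pathStarForm,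
    ← hc]
  congr 1
  simp only [Finset.sum_range_succ, Finset.sum_range_zero]
  rw [if_pos ((hrel 0 1 (by omega) (by omega)).2 (by omega)),
    if_pos ((hrel 0 2 (by omega) (by omega)).2 (by omega)),
    if_pos ((hrel 1 2 (by omega) (by omega)).2 (by omega)), hx 0 (by omega), hx 1 (by omega),
    hx 2 (by omega)]
  have s0 : pathStarSign c 0 = 1 := by simp [pathStarSign]
  have s1 : pathStarSign c 1 = 1 := by simp [pathStarSign]
  have s2 : pathStarSign c 2 = -1 := by
    rw [pathStarSign, if_neg (by omega), min_eq_left (by omega)]; norm_num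
  rw [s0, s1, s2]
  ring

/-- A connected non-bipartite graph all of whose edges belong to `graphU n k 3` is `graphU n k 3`. -/
theorem nonempty_iso_graphU {W : Type*} {G : SimpleGraph W} {n k : ℕ}
    (hkn : 3 + k ≤ n) (hG : G.Preconnected) (hodd : ¬ G.IsBipartite) (e : Fin n ≃ W)
    (hsub : ∀ p q, p < q → q < n → enumRel G e p q → q ≤ 2 ∨ p = min (q - 1) (n - k - 1)) :
    Nonempty (G ≃g graphU n k 3) := by
  obtain ⟨c, hc⟩ : ∃ c, c = n - k - 1 := ⟨_, rfl⟩
  rw [← hc] at hsub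
  have hsub' : ∀ i j : Fin n, G.Adj (e i) (e j) →
      (i.val < j.val ∧ (j.val ≤ 2 ∨ i.val = min (j.val - 1) c)) ∨
      (j.val < i.val ∧ (i.val ≤ 2 ∨ j.val = min (i.val - 1) c)) := by
    intro i j h
    rcases lt_trichotomy i.val j.val with hij | hij | hij
    · exact Or.inl ⟨hij, hsub _ _ hij j.2 (enumRel_val.2 h)⟩
    · rw [Fin.ext hij] at h; exact absurd h (G.loopless.irrefl _)
    · exact Or.inr ⟨hij, hsub _ _ hij i.2 (enumRel_val.2 h.symm)⟩
  have key : ∀ i j : Fin n, i < j →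
      (G.Adj (e i) (e j) ↔ (graphU n k 3).Adj i j) := by
    intro i j hij
    have hij' : i.val < j.val := hij
    have hjn := j.isLt
    rw [graphU_three_adj hkn hij, ← hc]
    refine ⟨fun h => hsub _ _ hij j.2 (enumRel_val.2 h), fun h => ?_⟩
    rcases Nat.lt_or_ge 2 j.val with h3 | h3
    -- The set consists of `j` and all that hangs below it, or of a single leaf. The edge to the
    -- parent is the only admissible one leaving it.
    · obtain ⟨u, v, hu, hv, huv⟩ := exists_adj_of_preconnected hG
        (fun w => ((j.val ≤ c ∧ j.val ≤ (e.symm w).val) ∨ (e.symm w).val = j.val))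
        (a := e j) (b := e ⟨0, by omega⟩) (by simp) (by simp; omega)
      obtain ⟨a, rfl⟩ := e.surjective u
      obtain ⟨b, rfl⟩ := e.surjective v
      simp only [Equiv.symm_apply_apply] at hu hv
      have h4 := hsub' a b huv
      have ha : a = j := Fin.ext (by omega)
      have hb : b = i := Fin.ext (by omega)
      rw [← ha, ← hb]; exact huv.symm
    -- In this colouring the triangle edge `i j` is the only admissible monochromatic one, so `G`
    -- must contain it.
    · obtain ⟨u, v, huv, hcol⟩ := exists_adj_of_not_isBipartite hodd fun w =>
        ((e.symm w).val = 0 ∧ ¬ (i.val = 0 ∧ j.val = 2)) ∨ ((e.symm w).val = 1 ∧ i.val ≠ 1) ∨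
          (2 ≤ (e.symm w).val ∧ min (e.symm w).val (c + 1) % 2 = 1)
      obtain ⟨a, rfl⟩ := e.surjective u
      obtain ⟨b, rfl⟩ := e.surjective v
      simp only [Equiv.symm_apply_apply] at hcol
      have h4 := hsub' a b huv
      have hab : (a.val = i.val ∧ b.val = j.val) ∨ (a.val = j.val ∧ b.val = i.val) := by omega
      rcases hab with ⟨h5, h6⟩ | ⟨h5, h6⟩
      · rw [← Fin.ext h5, ← Fin.ext h6]; exact huv
      · rw [← Fin.ext h5, ← Fin.ext h6]; exact huv.symm
  refine ⟨⟨e.symm, ?_⟩⟩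
  intro u v
  obtain ⟨a, rfl⟩ := e.surjective u
  obtain ⟨b, rfl⟩ := e.surjective v
  rw [Equiv.symm_apply_apply, Equiv.symm_apply_apply]
  rcases lt_trichotomy a b with h | h | h
  · exact (key a b h).symm
  · subst h; simp
  · rw [SimpleGraph.adj_comm, G.adj_comm]; exact (key b a h).symm

/-! ### The extremal theorem. -/

/-- The equation `(n - k - 1) / 3 + 1 = γ` bounds `k` below by `n - 3 * γ`; the bound on `γ` ensures
that `k = 1` is admissible when this difference is zero. -/
theorem minPendant_three {n γ : ℕ} (hn : 3 < n) (hγ : 1 ≤ γ) (hγn : 3 * γ ≤ n + 1) :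
    minPendant n γ 3 = max 1 (n - 3 * γ) := by
  have hmem : max 1 (n - 3 * γ) ∈
      {k : ℕ | 1 ≤ k ∧ 3 + k ≤ n ∧ dominationNumber (graphU n k 3) = γ} :=
    ⟨by omega, by omega, by rw [dominationNumber_graphU_three (by omega) (by omega)]; omega⟩
  refine le_antisymm (Nat.sInf_le hmem) (le_csInf ⟨_, hmem⟩ ?_)
  rintro k ⟨h1, h2, h3⟩
  rw [dominationNumber_graphU_three h1 h2] at h3
  omega

/-- Among the connected non-bipartite graphs with given order and domination number, a triangle with
a path and a star minimizes the least `Q`-eigenvalue, and it alone does. -/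
theorem qMin_graphU_three_le {W : Type*} [Fintype W] {G : SimpleGraph W} {n γ k : ℕ}
    (hn : 3 < n) (hγ : 1 ≤ γ) (hk : k = max 1 (n - 3 * γ)) (hG : IsConnNonbipDom n γ G) :
    qMin (graphU n k 3) ≤ qMin G ∧
      (qMin G = qMin (graphU n k 3) → Nonempty (G ≃g graphU n k 3)) := by
  classical
  obtain ⟨hW, hconn, hodd, hdom⟩ := hG
  have : Nonempty (Fin n) := ⟨⟨0, by omega⟩⟩
  have hne : Nonempty W := hconn.nonempty
  obtain ⟨D, hD, hDcard⟩ := exists_dominatingSet_card_eq G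
  rw [hdom] at hDcard
  obtain ⟨K, hK, hKcut, hKodd, hKdom⟩ := exists_core hconn.preconnected hodd hD
    (Finset.card_pos.1 (by omega))
  rw [hDcard, hW] at hK
  obtain ⟨m, hm⟩ : ∃ m, m = min (3 * γ) n := ⟨_, rfl⟩
  rw [← hm] at hK
  obtain ⟨x, hx, hxq⟩ := exists_qMin_form G
  obtain ⟨e, heK, hmono⟩ := exists_sorted_enum hW hK x
  have hA : ∀ i j : Fin n, G.Adj (e i) (e j) → enumRel G e i.val j.val := fun i j h =>
    enumRel_val.2 h
  have hmn : m ≤ n := by omega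
  have ha : ∀ i j, i ≤ j → j < m → |enumVec e x i| ≤ |enumVec e x j| := by
    intro i j hij hj
    have := hmono ⟨i, by omega⟩ ⟨j, by omega⟩ (by simpa using hij) hj
    rwa [← enumVec_val e x, ← enumVec_val e x] at this
  have hcut : ∀ i, 0 < i → i < m → ∃ u v, u < i ∧ i ≤ v ∧ v < m ∧ enumRel G e u v := by
    intro i hi him
    obtain ⟨u, hu, v, hv, h1, h2, huv⟩ := hKcut (fun w => (e.symm w).val < i)
      ⟨e ⟨0, by omega⟩, (heK _).1 (by simp only; omega), by simpa using hi⟩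
      ⟨e ⟨i, by omega⟩, (heK _).1 (by simpa using him), by simp⟩
    obtain ⟨a, rfl⟩ := e.surjective u
    obtain ⟨b, rfl⟩ := e.surjective v
    simp only [Equiv.symm_apply_apply] at h1 h2
    exact ⟨a.val, b.val, h1, by omega, (heK b).2 hv, hA a b huv⟩
  have hodd' : ∀ c : ℕ → Prop, ∃ u v, u < v ∧ v < m ∧ enumRel G e u v ∧ (c u ↔ c v) := by
    intro c
    obtain ⟨u, hu, v, hv, huv, h⟩ := hKodd fun w => c (e.symm w).val
    obtain ⟨a, rfl⟩ := e.surjective u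
    obtain ⟨b, rfl⟩ := e.surjective v
    simp only [Equiv.symm_apply_apply] at h
    rcases lt_trichotomy a b with hab | hab | hab
    · exact ⟨a, b, hab, (heK b).2 hv, hA a b huv, h⟩
    · subst hab; exact absurd huv (G.loopless.irrefl _)
    · exact ⟨b, a, hab, (heK a).2 hu, hA b a huv.symm, h.symm⟩
  have hf : ∀ j, ∃ u, m ≤ j → j < n → u < m ∧ enumRel G e u j := by
    intro j
    by_cases hj : m ≤ j ∧ j < n
    · obtain ⟨u, hu, huv⟩ := hKdom (e ⟨j, hj.2⟩) fun h => by
        have := (heK _).2 h; simp only at this; omega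
      obtain ⟨a, rfl⟩ := e.surjective u
      exact ⟨a.val, fun _ _ => ⟨(heK a).2 hu, hA a ⟨j, hj.2⟩ huv.symm⟩⟩
    · exact ⟨0, fun h1 h2 => absurd ⟨h1, h2⟩ hj⟩
  choose f hf using hf
  obtain ⟨c, hc⟩ : ∃ c, c = n - k - 1 := ⟨_, rfl⟩
  have hkn : 3 + k ≤ n := by omega
  -- For `3 * γ < n` the core ends at the star centre; otherwise `k = 1` and the core is the whole
  -- graph.
  have hmc : m = c + 1 ∨ (m = n ∧ n = c + 2) := by omega
  have hm3 : 3 ≤ m := by omega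
  have hform := pathStarForm_le_signlessForm hm3 hmn hmc ha hcut hodd' hf
  have hmin : ∀ h, qMin (graphU n k 3) * ∑ j ∈ Finset.range n, h j ^ 2 ≤ pathStarForm c n h :=
    fun h => hc ▸ qMin_graphU_mul_le (by omega) hkn h
  have hle : ∀ j, j < n → |enumVec e x j| ≤ foldVector (enumVec e x) m f j := fun j hj =>
    le_foldVector ha fun hmj => (hf j hmj hj).1
  have hsq : ∀ j ∈ Finset.range n,
      enumVec e x j ^ 2 ≤ foldVector (enumVec e x) m f j ^ 2 := fun j hj => by
    rw [← sq_abs]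
    exact pow_le_pow_left₀ (abs_nonneg _) (hle j (Finset.mem_range.1 hj)) 2
  have hsum := Finset.sum_le_sum hsq
  have hxsum : ∑ j ∈ Finset.range n, enumVec e x j ^ 2 = ∑ v, x v ^ 2 :=
    sum_range_enumVec e x fun t => t ^ 2
  have hxpos := sum_sq_pos hx
  rw [← hxsum] at hxpos hxq
  rw [dotProduct_eq_signlessForm G e] at hxq
  have hmin' := hmin (foldVector (enumVec e x) m f)
  have h0 := qMin_nonneg (graphU n k 3)
  refine ⟨?_, fun heq => ?_⟩
  · refine le_of_mul_le_mul_right ?_ hxpos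
    rw [← hxq]
    exact (mul_le_mul_of_nonneg_left hsum h0).trans (hmin'.trans hform)
  · rw [heq] at hxq
    have hb : pathStarForm c n (foldVector (enumVec e x) m f) ≤
        qMin (graphU n k 3) * ∑ j ∈ Finset.range n, foldVector (enumVec e x) m f j ^ 2 :=
      (hform.trans hxq.le).trans (mul_le_mul_of_nonneg_left hsum h0)
    have hcore : ∀ j, j < m → foldVector (enumVec e x) m f j = |enumVec e x j| := fun j hj =>
      if_pos hj
    obtain ⟨hlam, hlt⟩ := strictMono_of_minimizer (m := m) hm3 hmn hn (by omega)
      (fun j hj => (abs_nonneg _).trans (hle j hj))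
      (fun i j hij hj => by rw [hcore i (by omega), hcore j hj]; exact ha i j hij hj)
      (by
        by_contra! hcon
        refine absurd hsum (not_le.2 ?_)
        rw [Finset.sum_eq_zero fun j hj => by rw [hcon j (Finset.mem_range.1 hj)]; norm_num]
        exact hxpos) hmin hb
    -- Since `lam` is positive, equality of the forms forces equality of the norms, and thus of each
    -- entry.
    have hsumeq : ∑ j ∈ Finset.range n, enumVec e x j ^ 2 =
        ∑ j ∈ Finset.range n, foldVector (enumVec e x) m f j ^ 2 := by
      refine le_antisymm hsum (le_of_mul_le_mul_left ?_ hlam)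
      rw [← hxq]
      exact hmin'.trans hform
    have hnorm : ∀ j, j < n → foldVector (enumVec e x) m f j = |enumVec e x j| := by
      intro j hj
      have := (Finset.sum_eq_sum_iff_of_le hsq).1 hsumeq j (Finset.mem_range.2 hj)
      rw [← sq_abs] at this
      exact ((pow_left_inj₀ (abs_nonneg _) ((abs_nonneg _).trans (hle j hj)) two_ne_zero).1
        this).symm
    refine nonempty_iso_graphU hkn hconn.preconnected hodd e fun p q hpq hq hadj => ?_
    rw [← hc]
    refine edge_of_signlessForm_le hm3 hmn hmc ha hcut hodd' hf (fun i hi him => ?_)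
      (fun j hj hjn => ?_) (fun j _ hjn => hnorm j hjn) ?_ hpq hq hadj
    · have := hlt i hi (by omega)
      rwa [hnorm _ (by omega), hnorm _ (by omega), min_eq_left (by omega)] at this
    · have := hlt j (by omega) hjn
      rwa [hnorm _ (by omega), hnorm _ (by omega), show min (j - 1) c = m - 1 by omega] at this
    · rw [hxq, hsumeq]; exact hmin'

/-! ### The odd cycle against the graph with girth `n - 2`. -/

theorem cycleGraph_adj_val {n : ℕ} (hn : 3 ≤ n) (i j : Fin n) :
    (SimpleGraph.cycleGraph n).Adj i j ↔
      (i.val < j.val ∧ (j.val = i.val + 1 ∨ (i.val = 0 ∧ j.val = n - 1))) ∨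
      (j.val < i.val ∧ (i.val = j.val + 1 ∨ (j.val = 0 ∧ i.val = n - 1))) := by
  have hi := i.isLt
  have hj := j.isLt
  rw [SimpleGraph.cycleGraph_adj', Fin.sub_def, Fin.sub_def]
  simp only
  rcases lt_trichotomy i.val j.val with h | h | h
  · rw [Nat.mod_eq_of_lt (show n - j.val + i.val < n by omega),
      show n - i.val + j.val = j.val - i.val + n by omega, Nat.add_mod_right,
      Nat.mod_eq_of_lt (by omega)]
    omega
  · rw [h, show n - j.val + j.val = n by omega, Nat.mod_self]; omega
  · rw [Nat.mod_eq_of_lt (show n - i.val + j.val < n by omega),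
      show n - j.val + i.val = i.val - j.val + n by omega, Nat.add_mod_right,
      Nat.mod_eq_of_lt (by omega)]
    omega

theorem graphU_one_adj_val {n : ℕ} (hn : 5 ≤ n) (i j : Fin n) :
    (graphU n 1 (n - 2)).Adj i j ↔
      (i.val < j.val ∧ (j.val = i.val + 1 ∨ (i.val = 0 ∧ j.val = n - 3))) ∨
      (j.val < i.val ∧ (i.val = j.val + 1 ∨ (j.val = 0 ∧ i.val = n - 3))) := by
  have hi := i.isLt
  have hj := j.isLt
  simp only [graphU, SimpleGraph.fromRel_adj, ne_eq, Fin.ext_iff]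
  omega

theorem dominationNumber_graphU_one_le {n : ℕ} (hn : 5 ≤ n) :
    dominationNumber (graphU n 1 (n - 2)) ≤ (n + 2) / 3 := by
  classical
  let S : Finset (Fin n) :=
    (Finset.range ((n + 2) / 3)).image fun j => (⟨n - 2 - 3 * j, by omega⟩ : Fin n)
  have hmem : ∀ v : Fin n, v.val ≤ n - 2 → (n - 2 - v.val) % 3 = 0 → v ∈ S := fun v hv h =>
    Finset.mem_image.2 ⟨(n - 2 - v.val) / 3,
      Finset.mem_range.2 (show (n - 2 - v.val) / 3 < (n + 2) / 3 by omega),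
      Fin.ext (show n - 2 - 3 * ((n - 2 - v.val) / 3) = v.val by
        rw [Nat.mul_div_cancel' (Nat.dvd_of_mod_eq_zero h)]; omega)⟩
  refine (dominationNumber_le (S := S) fun v hv => ?_).trans
    (Finset.card_image_le.trans (Finset.card_range _).le)
  have hv2 := v.isLt
  rcases Nat.lt_or_ge (n - 2) v.val with h | h
  · exact ⟨⟨n - 2, by omega⟩, hmem _ le_rfl (by simp),
      (graphU_one_adj_val hn _ _).2 (by simp only; omega)⟩
  · have h0 : (n - 2 - v.val) % 3 ≠ 0 := fun h0 => hv (hmem v h h0)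
    by_cases h1 : (n - 2 - v.val) % 3 = 1
    · exact ⟨⟨v.val + 1, by omega⟩, hmem _ (by simp only; omega) (by simp only; omega),
        (graphU_one_adj_val hn _ _).2 (Or.inl ⟨Nat.lt_succ_self _, Or.inl rfl⟩)⟩
    · rcases Nat.eq_zero_or_pos v.val with hz | hz
      -- Here `n ≡ 1` modulo `3`, and truncated subtraction at the last index puts `0` itself into
      -- `S`.
      · exact absurd (Finset.mem_image.2 ⟨(n + 2) / 3 - 1, Finset.mem_range.2 (by omega),
          Fin.ext (by simp only; omega)⟩) hv
      · exact ⟨⟨v.val - 1, by omega⟩, hmem _ (by simp only; omega) (by simp only; omega),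
          (graphU_one_adj_val hn _ _).2 (by simp only; omega)⟩

open Fin.CommRing in
-- A vertex dominates only itself and its two neighbours.
theorem le_dominationNumber_cycleGraph (n : ℕ) :
    n + 2 ≤ 3 * dominationNumber (SimpleGraph.cycleGraph (n + 2)) := by
  classical
  obtain ⟨S, hS, hcard⟩ := exists_dominatingSet_card_eq (SimpleGraph.cycleGraph (n + 2))
  have hsub : (Finset.univ : Finset (Fin (n + 2))) ⊆ S ∪ (S.image (· + 1) ∪ S.image (· - 1)) := by
    intro v _
    by_cases hv : v ∈ S
    · simp [hv]
    · obtain ⟨u, hu, h⟩ := hS v hv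
      rw [SimpleGraph.cycleGraph_adj] at h
      simp only [Finset.mem_union, Finset.mem_image]
      rcases h with h | h
      · exact Or.inr (Or.inl ⟨u, hu, by rw [← h]; ring⟩)
      · exact Or.inr (Or.inr ⟨u, hu, by rw [← h]; ring⟩)
  have h1 := Finset.card_le_card hsub
  have h2 := Finset.card_union_le S (S.image (· + 1) ∪ S.image (· - 1))
  have h3 := Finset.card_union_le (S.image (· + 1)) (S.image (· - 1))
  have h4 : (S.image (· + 1)).card ≤ S.card := Finset.card_image_le
  have h5 : (S.image (· - 1)).card ≤ S.card := Finset.card_image_le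
  rw [Finset.card_univ, Fintype.card_fin] at h1
  omega

/-- A dominating set contains the pendant vertex `l` or its neighbour `p`. If the attachment vertex
`r` is chosen, then `l` serves in place of `p`, also dominating `0` in the cycle; if not, the chord
from `0` to `r` dominates nothing but possibly `r`, and `p` takes over `r` and `l`. -/
theorem dominationNumber_cycleGraph_le {n : ℕ} (hn : 5 ≤ n) :
    dominationNumber (SimpleGraph.cycleGraph n) ≤ dominationNumber (graphU n 1 (n - 2)) := by
  classical
  obtain ⟨S, hS, hcard⟩ := exists_dominatingSet_card_eq (graphU n 1 (n - 2))
  rw [← hcard]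
  obtain ⟨l, hl⟩ : ∃ l : Fin n, l.val = n - 1 := ⟨⟨n - 1, by omega⟩, rfl⟩
  obtain ⟨p, hp⟩ : ∃ p : Fin n, p.val = n - 2 := ⟨⟨n - 2, by omega⟩, rfl⟩
  obtain ⟨r, hr⟩ : ∃ r : Fin n, r.val = n - 3 := ⟨⟨n - 3, by omega⟩, rfl⟩
  have hlp : l ∈ S ∨ p ∈ S := by
    by_cases h : l ∈ S
    · exact Or.inl h
    · obtain ⟨u, hu, hadj⟩ := hS l h
      rw [graphU_one_adj_val hn] at hadj
      have : u = p := Fin.ext (by have := u.isLt; omega)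
      exact Or.inr (this ▸ hu)
  have hswap : ∀ a b : Fin n, (a ∈ S ∨ b ∈ S) → (insert a (S.erase b)).card ≤ S.card := by
    intro a b hab
    by_cases hb : b ∈ S
    · have := Finset.card_insert_le a (S.erase b)
      have := Finset.card_erase_add_one hb
      omega
    · rw [Finset.erase_eq_of_notMem hb, Finset.insert_eq_of_mem (hab.resolve_right hb)]
  by_cases hrS : r ∈ S
  · refine (dominationNumber_le (S := insert l (S.erase p)) fun v hv => ?_).trans
      (hswap l p hlp)
    simp only [Finset.mem_insert, Finset.mem_erase, not_or, not_and] at hv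
    have hvl : v.val ≠ n - 1 := fun h => hv.1 (Fin.ext (by omega))
    have hvn := v.isLt
    by_cases hv' : v.val = n - 2 ∨ v.val = 0
    · exact ⟨l, Finset.mem_insert_self _ _, (cycleGraph_adj_val (by omega) _ _).2 (by omega)⟩
    · have hvS : v ∉ S := hv.2 fun h => hv' (Or.inl (by rw [h, hp]))
      have hvr : v.val ≠ n - 3 := fun h => hvS (by
        rwa [show v = r from Fin.ext (by omega)])
      obtain ⟨u, hu, hadj⟩ := hS v hvS
      rw [graphU_one_adj_val hn] at hadj
      have hup : u ≠ p := fun h => by subst h; omega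
      exact ⟨u, by simp [hu, hup], (cycleGraph_adj_val (by omega) _ _).2 (by omega)⟩
  · refine (dominationNumber_le (S := insert p (S.erase l)) fun v hv => ?_).trans
      (hswap p l hlp.symm)
    simp only [Finset.mem_insert, Finset.mem_erase, not_or, not_and] at hv
    have hvp : v.val ≠ n - 2 := fun h => hv.1 (Fin.ext (by omega))
    have hvn := v.isLt
    by_cases hv' : v.val = n - 1 ∨ v.val = n - 3
    · exact ⟨p, Finset.mem_insert_self _ _, (cycleGraph_adj_val (by omega) _ _).2 (by omega)⟩
    · have hvS : v ∉ S := hv.2 fun h => hv' (Or.inl (by rw [h, hl]))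
      obtain ⟨u, hu, hadj⟩ := hS v hvS
      rw [graphU_one_adj_val hn] at hadj
      have hul : u ≠ l := fun h => by subst h; omega
      have hur : u.val ≠ n - 3 := fun h => hrS (by
        rwa [show r = u from Fin.ext (by omega)])
      exact ⟨u, by simp [hu, hul], (cycleGraph_adj_val (by omega) _ _).2 (by omega)⟩

theorem dominationNumber_graphU_one {n : ℕ} (hn : 5 ≤ n) :
    dominationNumber (graphU n 1 (n - 2)) = dominationNumber (SimpleGraph.cycleGraph n) := by
  have h1 := dominationNumber_graphU_one_le hn
  have h2 := dominationNumber_cycleGraph_le hn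
  obtain ⟨n, rfl⟩ : ∃ n', n = n' + 2 := ⟨n - 2, by omega⟩
  have h3 := le_dominationNumber_cycleGraph n
  omega

/-- The form of a path on `0, …, n - 1` with one further edge from `0` to `t`. -/
theorem signlessForm_path_add_edge {A : ℕ → ℕ → Prop} {n t : ℕ} (ht : 2 ≤ t) (htn : t < n)
    (hA : ∀ p q, p < q → q < n → (A p q ↔ q = p + 1 ∨ (p = 0 ∧ q = t))) (x : ℕ → ℝ) :
    signlessForm A n x = signlessForm (fun p q => q = p + 1) n x + (x 0 + x t) ^ 2 := by
  classical
  have h : edgePairs A n = insert (0, t) (edgePairs (fun p q => q = p + 1) n) := by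
    ext ⟨p, q⟩
    simp only [Finset.mem_insert, mem_edgePairs, Prod.mk.injEq]
    constructor
    · rintro ⟨h1, h2, h3⟩
      have := (hA p q h1 h2).1 h3
      omega
    · intro h
      have h1 : p < q := by omega
      have h2 : q < n := by omega
      exact ⟨h1, h2, (hA p q h1 h2).2 (by omega)⟩
  unfold signlessForm
  rw [h, Finset.sum_insert (by simp [mem_edgePairs]; omega), add_comm]

section Cycle

open Fin.CommRing

variable {n : ℕ}

theorem signlessLaplacian_cycleGraph_mulVec (x : Fin (n + 3) → ℝ) (v : Fin (n + 3)) :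
    (signlessLaplacian (SimpleGraph.cycleGraph (n + 3))).mulVec x v =
      2 * x v + x (v - 1) + x (v + 1) := by
  classical
  have hne : v - 1 ≠ v + 1 := by
    intro h
    have h2 : (2 : Fin (n + 3)) = 0 := by linear_combination -h
    simp only [Fin.ext_iff] at h2
    rw [show ((2 : Fin (n + 3))).val = 2 from
      Nat.mod_eq_of_lt (show 2 < n + 3 by omega)] at h2
    exact two_ne_zero h2
  rw [signlessLaplacian_mulVec_neighborFinset, SimpleGraph.cycleGraph_neighborFinset, Finset.sum_pair hne]
  ring

theorem add_eq_zero_of_dotProduct_eq_zero {W : Type*} [Fintype W] {G : SimpleGraph W} {x : W → ℝ}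
    (h : x ⬝ᵥ (signlessLaplacian G).mulVec x = 0) {u v : W} (huv : G.Adj u v) :
    x u + x v = 0 := by
  classical
  have h1 := dotProduct_signlessLaplacian G x
  rw [h, mul_zero] at h1
  have h2 : ∀ u v, 0 ≤ if G.Adj u v then (x u + x v) ^ 2 else 0 := fun u v => by
    split_ifs <;> positivity
  have h3 := (Finset.sum_eq_zero_iff_of_nonneg fun u _ => Finset.sum_nonneg fun v _ => h2 u v).1
    h1.symm u (Finset.mem_univ _)
  have h4 := (Finset.sum_eq_zero_iff_of_nonneg fun v _ => h2 u v).1 h3 v (Finset.mem_univ _)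
  rw [if_pos huv] at h4
  exact pow_eq_zero_iff two_ne_zero |>.1 h4

theorem qMin_cycleGraph_le_two : qMin (SimpleGraph.cycleGraph (n + 3)) ≤ 2 := by
  classical
  have h := qMin_mul_le (SimpleGraph.cycleGraph (n + 3)) (Pi.single 0 1)
  rw [single_one_dotProduct, signlessLaplacian_cycleGraph_mulVec] at h
  have h1 : (0 : Fin (n + 3)) - 1 ≠ 0 := by
    rw [zero_sub, neg_ne_zero]; simp
  have h2 : (0 : Fin (n + 3)) + 1 ≠ 0 := by
    rw [zero_add]; simp
  rw [Pi.single_eq_same, Pi.single_eq_of_ne h1, Pi.single_eq_of_ne h2,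
    Finset.sum_eq_single_of_mem (0 : Fin (n + 3)) (Finset.mem_univ _)
      (fun b _ hb => by rw [Pi.single_eq_of_ne hb]; norm_num), Pi.single_eq_same] at h
  linarith

theorem eq_zero_of_recurrence {x : Fin (n + 3) → ℝ} {μ : ℝ}
    (hrec : ∀ v, x (v - 1) + x (v + 1) = μ * x v) (h0 : x 0 = 0) (h1 : x (-1) = 0) : x = 0 := by
  have h : ∀ j : ℕ, x (j : Fin (n + 3)) = 0 ∧ x ((j : Fin (n + 3)) - 1) = 0 := by
    intro j
    induction j with
    | zero => simpa using ⟨h0, h1⟩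
    | succ j ih =>
      have := hrec (j : Fin (n + 3))
      rw [ih.1, ih.2] at this
      refine ⟨?_, ?_⟩
      · push_cast; linarith
      · push_cast; rw [add_sub_cancel_right]; exact ih.1
  ext v
  have := (h v.val).1
  rwa [Fin.cast_val_eq_self] at this

/-- The least `Q`-eigenvalue of an odd cycle has an eigenvector which is antisymmetric with respect
to the reflection `v ↦ -3 - v`. -/
theorem exists_antisymmetric_eigenvector (hodd : Odd (n + 3)) :
    ∃ w : Fin (n + 3) → ℝ, w ≠ 0 ∧ (∀ v, w (-3 - v) = - w v) ∧
      ∀ v, w (v - 1) + w (v + 1) = (qMin (SimpleGraph.cycleGraph (n + 3)) - 2) * w v := by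
  obtain ⟨z, hz, hzq⟩ := exists_eigenvector_qMin (SimpleGraph.cycleGraph (n + 3))
  have hrec : ∀ v, z (v - 1) + z (v + 1) =
      (qMin (SimpleGraph.cycleGraph (n + 3)) - 2) * z v := fun v => by
    have := congrFun hzq v
    rw [signlessLaplacian_cycleGraph_mulVec, Pi.smul_apply, smul_eq_mul] at this
    linarith
  -- A constant eigenvector has eigenvalue `4`, but the least one is at most `2`.
  obtain ⟨a, b, hab⟩ : ∃ a b, z a ≠ z b := by
    by_contra! hcon
    apply hz
    ext v
    have h1 := hrec v
    rw [hcon (v - 1) v, hcon (v + 1) v] at h1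
    have h2 := qMin_cycleGraph_le_two (n := n)
    have h3 : (4 - qMin (SimpleGraph.cycleGraph (n + 3))) * z v = 0 := by linarith
    exact (mul_eq_zero.1 h3).resolve_left (by linarith)
  -- As `n + 3 = 2 * t + 1`, the inverse of `2` is `t + 1`. Rotation by `s` carries the reflection
  -- exchanging `a` and `b` to `v ↦ -3 - v`, and `z a ≠ z b` keeps the antisymmetrization nonzero.
  obtain ⟨s, hs⟩ : ∃ s : Fin (n + 3), 2 * s = a + b + 3 := by
    obtain ⟨t, ht⟩ := hodd
    have h1 : ((2 * t + 1 : ℕ) : Fin (n + 3)) = 0 := by rw [← ht]; exact Fin.natCast_self _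
    push_cast at h1
    exact ⟨(a + b + 3) * ((t : Fin (n + 3)) + 1), by linear_combination (a + b + 3) * h1⟩
  refine ⟨fun v => z (v + s) - z (a + b - (v + s)), fun h => hab ?_, fun v => ?_, fun v => ?_⟩
  · have := congrFun h (a - s)
    simp only [Pi.zero_apply, sub_add_cancel, add_sub_cancel_left] at this
    linarith
  · have h1 : -3 - v + s = a + b - (v + s) := by linear_combination hs
    have h2 : a + b - (a + b - (v + s)) = v + s := by ring
    simp only [h1, h2]; ring
  · have h1 := hrec (v + s)
    have h2 := hrec (a + b - (v + s))
    have e1 : v - 1 + s = v + s - 1 := by ring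
    have e2 : v + 1 + s = v + s + 1 := by ring
    have e3 : a + b - (v + s - 1) = a + b - (v + s) + 1 := by ring
    have e4 : a + b - (v + s + 1) = a + b - (v + s) - 1 := by ring
    simp only [e1, e2, e3, e4]
    linarith

theorem qMin_graphU_one_lt_cycleGraph {n : ℕ} (hn : 5 ≤ n) (hodd : Odd n) :
    qMin (graphU n 1 (n - 2)) < qMin (SimpleGraph.cycleGraph n) := by
  obtain ⟨n, rfl⟩ : ∃ n', n = n' + 3 := ⟨n - 3, by omega⟩
  obtain ⟨w, hw, hanti, hrec⟩ := exists_antisymmetric_eigenvector hodd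
  have hpos := sum_sq_pos hw
  have heig : w ⬝ᵥ (signlessLaplacian (SimpleGraph.cycleGraph (n + 3))).mulVec w =
      qMin (SimpleGraph.cycleGraph (n + 3)) * ∑ v, w v ^ 2 := by
    rw [Finset.mul_sum]
    refine Finset.sum_congr rfl fun v _ => ?_
    rw [signlessLaplacian_cycleGraph_mulVec]
    linear_combination w v * hrec v
  -- Eigenvalue zero would make `w` alternate around an odd cycle.
  have hlam : qMin (SimpleGraph.cycleGraph (n + 3)) ≠ 0 := by
    intro h0
    rw [h0, zero_mul] at heig
    have hneg : ∀ j : ℕ, w (j : Fin (n + 3)) = (-1) ^ j * w 0 := by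
      intro j
      induction j with
      | zero => simp
      | succ j ih =>
        have := add_eq_zero_of_dotProduct_eq_zero heig (u := (j : Fin (n + 3)))
          (v := (j : Fin (n + 3)) + 1)
          (by rw [SimpleGraph.cycleGraph_adj]; right; ring)
        push_cast
        rw [pow_succ]
        linarith
    have hw0 : w 0 = 0 := by
      have := hneg (n + 3)
      rw [Fin.natCast_self, hodd.neg_one_pow] at this
      linarith
    apply hw
    ext v
    have := hneg v.val
    rwa [Fin.cast_val_eq_self, hw0, mul_zero] at this
  -- Antisymmetry gives `w (-2) = -w (-1)`. If also `w 0 = -w (-1)`, the recurrence at `-1` yields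
  -- `w (-1) = 0`, so two consecutive entries vanish and hence all do.
  have hne : w 0 + w (-1) ≠ 0 := by
    intro h0
    have h1 := hrec (-1)
    have h2 := hanti (-1)
    rw [show (-3 : Fin (n + 3)) - -1 = -1 - 1 by ring] at h2
    rw [h2, neg_add_cancel] at h1
    have h3 : qMin (SimpleGraph.cycleGraph (n + 3)) * w (-1) = 0 := by linarith
    have h4 := (mul_eq_zero.1 h3).resolve_left hlam
    exact hw (eq_zero_of_recurrence hrec (by linarith) h4)
  have h0 : w 0 + w (-3) = 0 := by
    have := hanti 0
    rw [sub_zero] at this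
    linarith
  have v0 : enumVec (Equiv.refl _) w 0 = w 0 := enumVec_val (Equiv.refl _) w 0
  have v1 : enumVec (Equiv.refl _) w (n + 3 - 1) = w (-1) := by
    have := enumVec_val (Equiv.refl _) w (-1)
    rwa [Fin.val_neg', show ((1 : Fin (n + 3))).val = 1 from
      Nat.mod_eq_of_lt (show 1 < n + 3 by omega),
      Nat.mod_eq_of_lt (by omega)] at this
  have v3 : enumVec (Equiv.refl _) w (n + 3 - 3) = w (-3) := by
    have := enumVec_val (Equiv.refl _) w (-3)
    rwa [Fin.val_neg', show ((3 : Fin (n + 3))).val = 3 from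
      Nat.mod_eq_of_lt (show 3 < n + 3 by omega),
      Nat.mod_eq_of_lt (by omega)] at this
  have hC : ∀ p q, p < q → q < n + 3 →
      (enumRel (SimpleGraph.cycleGraph (n + 3)) (Equiv.refl _) p q ↔
        q = p + 1 ∨ (p = 0 ∧ q = n + 3 - 1)) := by
    intro p q hpq hq
    have h := cycleGraph_adj_val (by omega) (⟨p, by omega⟩ : Fin (n + 3)) ⟨q, hq⟩
    simp only at h
    constructor
    · rintro ⟨_, _, h'⟩; have := h.1 h'; omega
    · intro h'; exact ⟨by omega, hq, h.2 (by omega)⟩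
  have hU : ∀ p q, p < q → q < n + 3 →
      (enumRel (graphU (n + 3) 1 (n + 3 - 2)) (Equiv.refl _) p q ↔
        q = p + 1 ∨ (p = 0 ∧ q = n + 3 - 3)) := by
    intro p q hpq hq
    have h := graphU_one_adj_val hn (⟨p, by omega⟩ : Fin (n + 3)) ⟨q, hq⟩
    simp only at h
    constructor
    · rintro ⟨_, _, h'⟩; have := h.1 h'; omega
    · intro h'; exact ⟨by omega, hq, h.2 (by omega)⟩
  have hle := qMin_mul_le (graphU (n + 3) 1 (n + 3 - 2)) w
  rw [dotProduct_eq_signlessForm _ (Equiv.refl _),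
    signlessForm_path_add_edge (by omega) (by omega) hU, v0, v3, h0] at hle
  rw [dotProduct_eq_signlessForm _ (Equiv.refl _),
    signlessForm_path_add_edge (by omega) (by omega) hC, v0, v1] at heig
  have hsq : 0 < (w 0 + w (-1)) ^ 2 := by positivity
  refine lt_of_mul_lt_mul_right ?_ hpos.le
  rw [← heig]
  linarith

end Cycle

theorem mainTheorem2 (n γ : ℕ) (hn : 3 < n) (hγ_pos : 1 ≤ γ)
    (hγ_le : (γ : ℝ) ≤ ((n : ℝ) + 1) / 3) :
    -- the index set over which the graph `V_n^γ(3)` minimises is non-empty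
    (∃ k : ℕ, 1 ≤ k ∧ 3 + k ≤ n ∧ dominationNumber (graphU n k 3) = γ) ∧
    -- `V_n^γ(3)` is the unique minimizing graph of the class
    IsConnNonbipDom n γ (graphV n γ 3) ∧
    (∀ (W : Type*) [Fintype W] (G : SimpleGraph W), IsConnNonbipDom n γ G →
      qMin (graphV n γ 3) ≤ qMin G ∧
      (qMin G = qMin (graphV n γ 3) ↔ Nonempty (G ≃g graphV n γ 3))) ∧
    -- the comparison of the odd cycle `C_n` with `U_n^1(n - 2)`
    (5 ≤ n → Odd n →
      dominationNumber (graphU n 1 (n - 2)) = dominationNumber (SimpleGraph.cycleGraph n) ∧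
      qMin (graphU n 1 (n - 2)) < qMin (SimpleGraph.cycleGraph n)) := by
  have hγn : 3 * γ ≤ n + 1 := by
    have : (3 * γ : ℝ) ≤ n + 1 := by linarith
    exact_mod_cast this
  obtain ⟨k, hk⟩ : ∃ k, k = max 1 (n - 3 * γ) := ⟨_, rfl⟩
  have hk1 : 1 ≤ k := by omega
  have hkn : 3 + k ≤ n := by omega
  have hdom : dominationNumber (graphU n k 3) = γ := by
    rw [dominationNumber_graphU_three hk1 hkn]; omega
  have hV : graphV n γ 3 = graphU n k 3 := by
    rw [graphV, minPendant_three hn hγ_pos hγn, hk]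
  rw [hV]
  refine ⟨⟨k, hk1, hkn, hdom⟩, ⟨Fintype.card_fin n, graphU_three_connected hk1 hkn,
    graphU_three_not_isBipartite hkn, hdom⟩, fun W _ G hG => ?_, fun h5 hodd =>
    ⟨dominationNumber_graphU_one h5, qMin_graphU_one_lt_cycleGraph h5 hodd⟩⟩
  obtain ⟨hle, hiso⟩ := qMin_graphU_three_le hn hγ_pos hk hG
  have : Nonempty W := hG.2.1.nonempty
  have : Nonempty (Fin n) := ⟨⟨0, by omega⟩⟩
  exact ⟨hle, hiso, fun ⟨φ⟩ => qMin_congr φ⟩
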